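/- **Setting.** Let $\Lambda\subset\mathbb Z^k$ be a finite set of $n$ sites with the nearest-neighbour graph ($x\sim y$ iff $\sum_i|x_i-y_i|=1$), one qubit per site, and let $\mathcal B(A,r)$ be the set of sites at graph distance at most $r$ from $A\subseteq\Lambda$. A depth-$d$ circuit has at most $d$ layers of non-overlapping two-qubit gates (arbitrary unitaries); a lattice circuit is one whose gates act on neighbouring sites. An $(\ell,c,d)$ covering scheme consists of sets $S^i_j\subseteq\Lambda$ ($1\le i\le\ell$, $1\le j\le m_i$) such that (1) $|\mathcal B(S^i_j,d)|\le c$; (2) for each fixed $i$ the sets $\mathcal B(S^i_j,d)$, $1\le j\le m_i$, are pairwise disjoint; (3) each site $v$ has some $S^i_j\supseteq\mathcal B(\{v\},(2\ell-1)d)$. A local inversion of $A$ for a state $|\psi\rangle$ is a depth-$d$ lattice circuit $V$ supported on $\mathcal B(A,d)$ with $V|\psi\rangle=|0\rangle_A\otimes|\phi\rangle$ for some pure state $|\phi\rangle$. Given local inversions $V_{i,j}$ of all $S^i_j$, the reconstruction process $W$ is the circuit with resets which, successively for $i=1,\dots,\ell$, applies all $V_{i,j}$ ($1\le j\le m_i$)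 in parallel, resets all qubits of $\bigcup_jS^i_j$ to $|0\rangle$, and applies all $V_{i,j}^\dagger$ in parallel. The backward lightcone of all output wires of $W$ is the part of the diagram of $W$ obtained by colouring all output wires blue and then, until nothing changes, colouring green every two-qubit gate with a blue wire on top and colouring blue those of its lower wires that do not come directly from a reset gate (blue continues down a wire until it meets a gate or a reset). It consists of the green gates, acting on the wires into which the resets cut the world lines of the qubits. **Theorem.** Let $|\psi\rangle=U|0^n\rangle$ with $U$ a depth-$d$ lattice circuit on $\Lambda$, and let $(S^i_j)$ be an $(\ell,c,d)$ covering scheme for $\Lambda$. Then every $S^i_j$ has a local inversion for $|\psi\rangle$, and for every choice of local inversions $V_{i,j}$ of the $S^i_j$ the reconstruction process $W$ satisfies: 1. $W$ fixes $|\psi\rangle$, i.e. as a quantum channel it maps $|\psi\rangle\langle\psi|$ to itself. 2. The backward lightcone of all output wires of $W$ never reaches the input of $W$. It is a circuit $C$ of depth at most $(2\ell-1)d$ that is part of $W$; all its wires start in $|0\rangle$, and they are the $n$ output wires of $W$ together with $m$ further wires (ancillas) of $W$, where $m\le(\ell-1)n$. 3. $C\,|0^n\rangle|0^m\rangle=|\psi\rangle\otimes|\mathrm{junk}\rangle$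 for some pure state $|\mathrm{junk}\rangle$ of the $m$ ancillas. -/

import Mathlib

open scoped Matrix

namespace ShallowLearning

/-! ## States, two-qubit gates and circuits without resets -/

/-- State vectors of qubits labelled by `ι`; `x : ι → Fin 2` labels the computational basis. -/
abbrev StateVec (ι : Type*) := (ι → Fin 2) → ℂ

/-- Operators (in particular density matrices) on the qubits labelled by `ι`. -/
abbrev Operator (ι : Type*) := Matrix (ι → Fin 2) (ι → Fin 2) ℂ

/-- The vector has norm one. -/
def IsState {ι : Type*} [Fintype ι] [DecidableEq ι] (φ : StateVec ι) : Prop :=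
  ∑ x, ‖φ x‖ ^ 2 = 1

/-- The all-zero state `|0…0⟩`. -/
def zeroState (ι : Type*) [Fintype ι] [DecidableEq ι] : StateVec ι :=
  fun x => if x = 0 then 1 else 0

/-- `φ ⊗ χ`. -/
def tensor {α β : Type*} (φ : StateVec α) (χ : StateVec β) : StateVec (α ⊕ β) :=
  fun x => φ (x ∘ Sum.inl) * χ (x ∘ Sum.inr)

/-- `|0⟩_A ⊗ φ`, where `φ` is a vector on the qubits outside `A`. -/
def zeroOn {ι : Type*} [DecidableEq ι] (A : Finset ι)
    (φ : StateVec {q : ι // q ∉ A}) : StateVec ι :=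
  fun x => if ∀ q ∈ A, x q = 0 then φ (fun q => x q.1) else 0

/-- The pure density matrix `|ψ⟩⟨ψ|`. -/
def pureState {ι : Type*} (ψ : StateVec ι) : Operator ι :=
  Matrix.vecMulVec ψ (star ψ)

/-- A two-qubit gate: an arbitrary unitary acting on an ordered pair of distinct wires. -/
structure Gate (ι : Type*) where
  fst : ι
  snd : ι
  ne : fst ≠ snd
  mat : Matrix.unitaryGroup (Fin 2 × Fin 2) ℂ

namespace Gate

variable {ι κ : Type*}

/-- The two wires on which the gate acts. -/
def support [DecidableEq ι] (g : Gate ι) : Finset ι := {g.fst, g.snd}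

/-- The gate as an operator on all qubits (identity away from its two wires). -/
def op [DecidableEq ι] [Fintype ι] (g : Gate ι) : Operator ι :=
  Matrix.of fun x y =>
    if ∀ q, q ≠ g.fst → q ≠ g.snd → x q = y q then
      g.mat.1 (x g.fst, x g.snd) (y g.fst, y g.snd)
    else 0

/-- The inverse gate. -/
def inv (g : Gate ι) : Gate ι := ⟨g.fst, g.snd, g.ne, g.mat⁻¹⟩

/-- The same gate on relabelled wires. -/
def map (e : ι ↪ κ) (g : Gate ι) : Gate κ :=
  ⟨e g.fst, e g.snd, fun h => g.ne (e.injective h), g.mat⟩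

end Gate

/-- A layer is a list of gates; in a genuine circuit they do not overlap, see `Layer.IsValid`. -/
abbrev Layer (ι : Type*) := List (Gate ι)

/-- A circuit is a list of layers, the first one being applied first.
Its depth is the length of the list. -/
abbrev Circuit (ι : Type*) := List (Layer ι)

namespace Layer

variable {ι κ : Type*}

/-- The gates of the layer do not overlap. -/
def IsValid [DecidableEq ι] (L : Layer ι) : Prop :=
  L.Pairwise fun g h => Disjoint g.support h.support

/-- The operator of a layer. -/
def op [DecidableEq ι] [Fintype ι] : Layer ι → Operator ι
  | [] => 1
  | g :: L => op L * g.op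

end Layer

namespace Circuit

variable {ι κ : Type*}

/-- The operator of a circuit. -/
def op [DecidableEq ι] [Fintype ι] : Circuit ι → Operator ι
  | [] => 1
  | L :: C => op C * Layer.op L

/-- The inverse circuit `C†`: inverse gates in reverse order. -/
def inv (C : Circuit ι) : Circuit ι :=
  (List.map (List.map Gate.inv) C).reverse

/-- The same circuit on relabelled wires. -/
def map (e : ι ↪ κ) (C : Circuit ι) : Circuit κ :=
  List.map (List.map (Gate.map e)) C

/-- `C` is a circuit of depth at most `d`: it has at most `d` layers, each of which consists of
non-overlapping two-qubit gates. -/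
structure IsDepth [DecidableEq ι] (C : Circuit ι) (d : ℕ) : Prop where
  length_le : C.length ≤ d
  valid : ∀ L ∈ C, Layer.IsValid L

/-- Each gate acts on two neighbouring sites of `G`. -/
def IsLocal (G : SimpleGraph ι) (C : Circuit ι) : Prop :=
  ∀ L ∈ C, ∀ g ∈ L, G.Adj g.fst g.snd

/-- Each gate acts inside the region `B`. -/
def IsSupportedOn [DecidableEq ι] (C : Circuit ι) (B : Finset ι) : Prop :=
  ∀ L ∈ C, ∀ g ∈ L, g.support ⊆ B

/-- Run a family of circuits of depth at most `d` in parallel: the `t`-th layer collects the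
`t`-th layers of all members (circuits with fewer layers idle at the end). -/
def parallel {m : ℕ} (d : ℕ) (V : Fin m → Circuit ι) : Circuit ι :=
  (List.range d).map fun t => (List.finRange m).flatMap fun j => (V j).getD t []

end Circuit

/-! ## The lattice, balls, covering schemes -/

/-- The nearest-neighbour graph on a finite set of sites `Λ` of the `k`-dimensional lattice `ℤ^k`:
two sites are adjacent iff their `ℓ¹`-distance is one. -/
def latticeGraph {k : ℕ} (Λ : Finset (Fin k → ℤ)) : SimpleGraph Λ where
  Adj x y := ∑ i, |x.1 i - y.1 i| = 1
  symm := ⟨fun x y h => by simpa only [abs_sub_comm] using h⟩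
  loopless := ⟨fun x h => by simp at h⟩

open Classical in
/-- The radius-`r` neighbourhood of `A`, with respect to the graph distance. -/
noncomputable def ball {ι : Type*} [Fintype ι] (G : SimpleGraph ι) (A : Finset ι) (r : ℕ) :
    Finset ι :=
  Finset.univ.filter fun v => ∃ a ∈ A, G.edist a v ≤ (r : ℕ∞)

/-- An `(ℓ, c, d)` covering scheme. -/
structure CoveringScheme {ι : Type*} [Fintype ι] (G : SimpleGraph ι) (ℓ c d : ℕ) where
  /-- number of regions in each layer -/
  m : Fin ℓ → ℕ
  /-- the regions -/
  S : (i : Fin ℓ) → Fin (m i) → Finset ι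
  card_ball_le : ∀ i j, (ball G (S i j) d).card ≤ c
  disjoint_balls : ∀ i, Pairwise fun j j' => Disjoint (ball G (S i j) d) (ball G (S i j') d)
  covers : ∀ v, ∃ i j, ball G {v} ((2 * ℓ - 1) * d) ⊆ S i j

/-- `V` is a depth-`d` local inversion of the region `A` for the state `ψ`: a depth-`d` circuit of
nearest-neighbour gates supported on the radius-`d` ball around `A` with `V ψ = |0⟩_A ⊗ φ` for
some pure state `φ` on the remaining qubits. -/
structure IsLocalInversion {ι : Type*} [Fintype ι] [DecidableEq ι] (G : SimpleGraph ι)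
    (ψ : StateVec ι) (A : Finset ι) (d : ℕ) (V : Circuit ι) : Prop where
  depth : V.IsDepth d
  isLocal : V.IsLocal G
  supported : V.IsSupportedOn (ball G A d)
  inverts : ∃ φ : StateVec {q : ι // q ∉ A}, IsState φ ∧ V.op *ᵥ ψ = zeroOn A φ

/-! ## Circuits with reset gates -/

/-- One time step of a circuit with resets: a layer of two-qubit gates, or one-qubit reset gates
on a set of qubits. -/
inductive Step (ι : Type*) where
  | gates (L : Layer ι) : Step ι
  | reset (R : Finset ι) : Step ι

/-- A circuit with resets; the first step of the list is applied first. -/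
abbrev ResetCircuit (ι : Type*) := List (Step ι)

section Channel

variable {ι : Type*} [DecidableEq ι] [Fintype ι]

/-- Overwrite the values of `x` on `R` by `z`. -/
def fill (R : Finset ι) (z : R → Fin 2) (x : ι → Fin 2) : ι → Fin 2 :=
  fun q => if h : q ∈ R then z ⟨q, h⟩ else x q

/-- The reset channel `ρ ↦ |0⟩⟨0|_R ⊗ Tr_R ρ`. -/
def resetChannel (R : Finset ι) (ρ : Operator ι) : Operator ι :=
  Matrix.of fun x y =>
    if ∀ q ∈ R, x q = 0 ∧ y q = 0 then ∑ z : R → Fin 2, ρ (fill R z x) (fill R z y) else 0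

/-- The quantum channel of one time step. -/
def Step.channel : Step ι → Operator ι → Operator ι
  | .gates L, ρ => L.op * ρ * (L.op)ᴴ
  | .reset R, ρ => resetChannel R ρ

/-- The quantum channel of a circuit with resets. -/
def ResetCircuit.channel : ResetCircuit ι → Operator ι → Operator ι
  | [], ρ => ρ
  | s :: W, ρ => ResetCircuit.channel W (s.channel ρ)

end Channel

/-- The reconstruction process: for each layer `i` of the covering scheme, apply all `V i j` in
parallel, reset all qubits of all regions `S i j`, and apply all `(V i j)†` in parallel. -/
def reconstruction {ι : Type*} [DecidableEq ι] {ℓ : ℕ} {m : Fin ℓ → ℕ} (d : ℕ)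
    (S : (i : Fin ℓ) → Fin (m i) → Finset ι) (V : (i : Fin ℓ) → Fin (m i) → Circuit ι) :
    ResetCircuit ι :=
  (List.finRange ℓ).flatMap fun i =>
    List.map Step.gates (Circuit.parallel d (V i))
      ++ [Step.reset (Finset.univ.biUnion (S i))]
      ++ List.map Step.gates (Circuit.parallel d (V i)).inv

/-! ## The backward lightcone

All functions recurse from the output (end of the list) down to the input. -/

namespace ResetCircuit

variable {ι : Type*} [DecidableEq ι]

/-- The gates of `L` that have a blue wire on top, `B` being the set of blue wires above `L`. -/
def greenGates (L : Layer ι) (B : Finset ι) : Layer ι :=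
  L.filter fun g => g.fst ∈ B ∨ g.snd ∈ B

/-- The blue wires at the bottom of `W`, when the output wires in `A` have been coloured blue.
Blue spreads downwards through every green gate to both of its lower wires, and stops at resets. -/
def blue (A : Finset ι) : ResetCircuit ι → Finset ι
  | [] => A
  | .gates L :: W =>
      blue A W ∪ ((greenGates L (blue A W)).map Gate.support).foldr (· ∪ ·) ∅
  | .reset R :: W => blue A W \ R

/-- The number of reset gates on each qubit in `W`. -/
def resetCount : ResetCircuit ι → ι → ℕ
  | [], _ => 0
  | .gates _ :: W, q => resetCount W q
  | .reset R :: W, q => resetCount W q + if q ∈ R then 1 else 0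

/-- The resets cut the world line of each qubit `q` into wires; `(q, s)` is the one with exactly
`s` reset gates above it, so `(q, 0)` is the output wire of `q`.
This is the wire of `q` at the bottom of `W`. -/
def wire (W : ResetCircuit ι) : ι ↪ ι × ℕ :=
  ⟨fun q => (q, resetCount W q), fun _ _ h => congrArg Prod.fst h⟩

/-- The green gates of each layer of `W`, as gates on the wires of the diagram of `W`. -/
def greenLayers (A : Finset ι) : ResetCircuit ι → Circuit (ι × ℕ)
  | [] => []
  | .gates L :: W => (greenGates L (blue A W)).map (Gate.map (wire W)) :: greenLayers A W
  | .reset _ :: W => greenLayers A W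

/-- The backward lightcone of the outputs `A`: the green part of the diagram of `W`, with the
layers that contain no green gate removed. -/
def backwardLightcone (A : Finset ι) (W : ResetCircuit ι) : Circuit (ι × ℕ) :=
  (greenLayers A W).filter fun L => !L.isEmpty

/-- The wires of the diagram of `W` that belong to the backward lightcone of `A`. -/
def lightconeWires (A : Finset ι) : ResetCircuit ι → Finset (ι × ℕ)
  | [] => A.map (wire [])
  | s :: W => lightconeWires A W ∪ (blue A (s :: W)).map (wire (s :: W))

end ResetCircuit

end ShallowLearning

open ShallowLearning

/-!
All operators are described through their action on state vectors (`Gate.act`, `Layer.act`).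

**Local inversions.** A circuit is its backward lightcone of a set `A` of outputs, followed by gates
that do not touch `A` (`Circuit.exists_cone_eq`). For the circuit `U†` this says that its lightcone
of `A` takes `U|0…0⟩` to the image of `|0…0⟩` under gates away from `A`, hence to `|0⟩_A ⊗ φ`
(`exists_isLocalInversion`).

**The reconstruction process fixes `ψ`.** The local inversions of one layer have disjoint supports,
so together they bring all regions of the layer to `|0⟩` (`vanishes_parallel`). The reset then does
nothing, and the inverse circuits lead back to `ψ`: this is a `CleanRun` from `ψ` to `ψ`.

**The lightcone.** The lightcone of an output `v` spreads by at most one lattice step per layer of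
gates. Hence it stays inside the ball of radius `(2ℓ - 1)d` until it reaches the resets of the layer
one of whose regions contains this ball, and there it ends (`blue_reconstructionTail`). All
lightcones therefore end at or above the first resets, below which only `d` layers of gates lie.

**The state prepared by the lightcone.** Consider the diagram of `W` as a circuit without resets on
all wires. As every reset finds its qubits in the state `|0⟩`, the old wire that it discards and the
fresh wire that it supplies are both in the state `|0⟩`. So the diagram takes `ψ` on the input wires
and `|0⟩` elsewhere to `ψ` on the output wires and `|0⟩` elsewhere (`CleanRun.act_diagram`). The
lightcone of the outputs differs from the diagram by gates away from the output wires, so it takes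
the same initial state to `ψ ⊗ junk'`. As it does not touch the input wires, these can be contracted
with a basis state in which `ψ` has a nonzero amplitude, which leaves `C|0…0⟩ = ψ ⊗ junk`
(`exists_lightcone_circuit`).
-/

namespace ShallowLearning

variable {ι κ : Type*}

/-! ### Inverse circuits, and gates that do not touch a set of qubits -/

theorem Circuit.mem_inv {C : Circuit ι} {L : Layer ι} :
    L ∈ C.inv ↔ ∃ M ∈ C, List.map Gate.inv M = L := by
  simp [Circuit.inv]

theorem Circuit.IsLocal.inv {G : SimpleGraph ι} {C : Circuit ι} (hC : C.IsLocal G) :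
    C.inv.IsLocal G := by
  intro L hL g hg
  obtain ⟨M, hM, rfl⟩ := Circuit.mem_inv.1 hL
  obtain ⟨h, hh, rfl⟩ := List.mem_map.1 hg
  exact hC M hM h hh

/-- No gate of the list acts on a qubit in `A`. -/
def Layer.Avoids (L : Layer ι) (A : Set ι) : Prop :=
  ∀ g ∈ L, g.fst ∉ A ∧ g.snd ∉ A

theorem Layer.Avoids.append {L M : Layer ι} {A : Set ι} (hL : L.Avoids A) (hM : M.Avoids A) :
    Layer.Avoids (L ++ M) A := by
  intro g hg
  exact (List.mem_append.1 hg).elim (hL g) (hM g)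

theorem Layer.Avoids.reverse_inv {L : Layer ι} {A : Set ι} (hL : L.Avoids A) :
    Layer.Avoids (L.map Gate.inv).reverse A := by
  intro g hg
  obtain ⟨h, hh, rfl⟩ := List.mem_map.1 (List.mem_reverse.1 hg)
  exact hL h hh

/-! ### The action of gates on state vectors -/

section Action

variable [DecidableEq ι] [DecidableEq κ]

/-- The bit string `x` with the bits on the two wires of `g` replaced by `p`. -/
def Gate.overwrite (g : Gate ι) (x : ι → Fin 2) (p : Fin 2 × Fin 2) : ι → Fin 2 :=
  Function.update (Function.update x g.fst p.1) g.snd p.2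

/-- The action of a gate on state vectors. Unlike `Gate.op`, this makes sense for infinitely many
qubits, so that it applies to the wires `ι × ℕ` of a circuit with resets. -/
def Gate.act (g : Gate ι) (f : StateVec ι) : StateVec ι :=
  fun x => ∑ p, g.mat.1 (x g.fst, x g.snd) p * f (g.overwrite x p)

/-- The action of a list of gates, the first one being applied first. -/
def Layer.act (L : Layer ι) (f : StateVec ι) : StateVec ι :=
  L.foldl (fun f g => g.act f) f

theorem Gate.overwrite_apply (g : Gate ι) (x : ι → Fin 2) (p : Fin 2 × Fin 2) (q : ι) :
    g.overwrite x p q = if q = g.snd then p.2 else if q = g.fst then p.1 else x q := by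
  simp only [Gate.overwrite, Function.update_apply]

@[simp] theorem Gate.overwrite_fst (g : Gate ι) (x : ι → Fin 2) (p : Fin 2 × Fin 2) :
    g.overwrite x p g.fst = p.1 := by
  simp [Gate.overwrite_apply, g.ne]

@[simp] theorem Gate.overwrite_snd (g : Gate ι) (x : ι → Fin 2) (p : Fin 2 × Fin 2) :
    g.overwrite x p g.snd = p.2 := by
  simp [Gate.overwrite_apply]

theorem Gate.overwrite_of_ne (g : Gate ι) (x : ι → Fin 2) (p : Fin 2 × Fin 2) {q : ι}
    (h₁ : q ≠ g.fst) (h₂ : q ≠ g.snd) : g.overwrite x p q = x q := by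
  simp [Gate.overwrite_apply, h₁, h₂]

@[simp] theorem Gate.overwrite_overwrite (g : Gate ι) (x : ι → Fin 2) (p r : Fin 2 × Fin 2) :
    g.overwrite (g.overwrite x p) r = g.overwrite x r := by
  funext q
  simp only [Gate.overwrite_apply]
  split_ifs <;> rfl

@[simp] theorem Gate.overwrite_self (g : Gate ι) (x : ι → Fin 2) :
    g.overwrite x (x g.fst, x g.snd) = x := by
  simp [Gate.overwrite]

theorem Gate.mem_support {g : Gate ι} {q : ι} : q ∈ g.support ↔ q = g.fst ∨ q = g.snd := by
  simp [Gate.support]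

theorem Gate.act_comm {g h : Gate ι} (H : Disjoint g.support h.support) (f : StateVec ι) :
    g.act (h.act f) = h.act (g.act f) := by
  simp only [Gate.support, Finset.disjoint_insert_left, Finset.disjoint_singleton_left,
    Finset.mem_insert, Finset.mem_singleton, not_or] at H
  obtain ⟨⟨h1, h2⟩, h3, h4⟩ := H
  funext x
  simp only [Gate.act, Finset.mul_sum]
  rw [Finset.sum_comm]
  refine Finset.sum_congr rfl fun q _ => Finset.sum_congr rfl fun p _ => ?_
  have e : h.overwrite (g.overwrite x p) q = g.overwrite (h.overwrite x q) p := by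
    funext r
    simp only [Gate.overwrite_apply]
    split_ifs <;> simp_all
  rw [e, g.overwrite_of_ne x p (Ne.symm h1) (Ne.symm h3),
    g.overwrite_of_ne x p (Ne.symm h2) (Ne.symm h4),
    h.overwrite_of_ne x q h1 h2, h.overwrite_of_ne x q h3 h4]
  ring

theorem Gate.inv_act_act (g : Gate ι) (f : StateVec ι) : g.inv.act (g.act f) = f := by
  funext x
  have hov : ∀ y p, g.inv.overwrite y p = g.overwrite y p := fun _ _ => rfl
  simp only [Gate.act, Finset.mul_sum, hov, Gate.overwrite_overwrite, Gate.overwrite_fst,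
    Gate.overwrite_snd]
  rw [Finset.sum_comm]
  have key : (g.mat⁻¹).1 * g.mat.1 = 1 := by
    rw [← Submonoid.coe_mul, inv_mul_cancel, Submonoid.coe_one]
  have : ∀ r, ∑ p, g.inv.mat.1 (x g.fst, x g.snd) p * (g.mat.1 p r * f (g.overwrite x r))
      = (1 : Matrix (Fin 2 × Fin 2) (Fin 2 × Fin 2) ℂ) (x g.fst, x g.snd) r
        * f (g.overwrite x r) := by
    intro r
    rw [← key, Matrix.mul_apply, Finset.sum_mul]
    exact Finset.sum_congr rfl fun p _ => (mul_assoc _ _ _).symm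
  refine (Finset.sum_congr rfl fun r _ => this r).trans ?_
  rw [Finset.sum_eq_single (x g.fst, x g.snd)]
  · simp
  · intro r _ hr
    rw [Matrix.one_apply_ne hr.symm, zero_mul]
  · simp

@[simp] theorem Layer.act_nil (f : StateVec ι) : Layer.act [] f = f := rfl

@[simp] theorem Layer.act_cons (g : Gate ι) (L : Layer ι) (f : StateVec ι) :
    Layer.act (g :: L) f = Layer.act L (g.act f) := rfl

@[simp] theorem Layer.act_append (L M : Layer ι) (f : StateVec ι) :
    Layer.act (L ++ M) f = Layer.act M (Layer.act L f) := by
  simp [Layer.act]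

theorem Layer.act_gate_comm {g : Gate ι} {L : Layer ι}
    (H : ∀ h ∈ L, Disjoint g.support h.support) (f : StateVec ι) :
    Layer.act L (g.act f) = g.act (Layer.act L f) := by
  induction L generalizing f with
  | nil => rfl
  | cons h L ih =>
    rw [Layer.act_cons, Layer.act_cons, ← Gate.act_comm (H h (by simp)),
      ih fun h' hh' => H h' (by simp [hh'])]

theorem Layer.act_comm {L M : Layer ι}
    (H : ∀ g ∈ L, ∀ h ∈ M, Disjoint g.support h.support) (f : StateVec ι) :
    Layer.act L (Layer.act M f) = Layer.act M (Layer.act L f) := by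
  induction L generalizing f with
  | nil => rfl
  | cons g L ih =>
    rw [Layer.act_cons, Layer.act_cons, ← Layer.act_gate_comm (H g (by simp)),
      ih fun g' hg' => H g' (by simp [hg'])]

/-- If the gates selected by `p` do not overlap the others, they may be applied first. -/
theorem Layer.act_eq_act_filter (p : Gate ι → Bool) {L : Layer ι}
    (H : ∀ g ∈ L, ∀ h ∈ L, p g = true → p h = false → Disjoint g.support h.support)
    (f : StateVec ι) :
    Layer.act L f = Layer.act (L.filter fun g => !p g) (Layer.act (L.filter p) f) := by
  induction L generalizing f with
  | nil => rfl
  | cons g L ih =>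
    have ih := ih fun a ha b hb => H a (by simp [ha]) b (by simp [hb])
    rw [Layer.act_cons, ih]
    cases hg : p g with
    | true => simp [hg]
    | false =>
      simp only [hg, List.filter_cons, Bool.not_false, if_true, Layer.act_cons]
      rw [Layer.act_gate_comm]
      · simp
      · intro h hh
        rw [List.mem_filter] at hh
        exact (H h (by simp [hh.1]) g (by simp) hh.2 hg).symm

theorem Layer.IsValid.disjoint {L : Layer ι} (hL : L.IsValid) {g h : Gate ι} (hg : g ∈ L)
    (hh : h ∈ L) (hne : g ≠ h) : Disjoint g.support h.support :=
  haveI : Std.Symm fun g h : Gate ι => Disjoint g.support h.support := ⟨fun _ _ h => h.symm⟩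
  List.Pairwise.forall hL hg hh hne

/-- The inverse gates of a list of gates, in reverse order, undo it. -/
theorem Layer.act_reverse_inv_act (L : Layer ι) (f : StateVec ι) :
    Layer.act (L.map Gate.inv).reverse (Layer.act L f) = f := by
  induction L generalizing f with
  | nil => rfl
  | cons g L ih => simp [ih, Gate.inv_act_act]

/-- As the gates of a layer commute, their inverses undo the layer in any order. -/
theorem Layer.IsValid.act_inv_act {L : Layer ι} (hL : L.IsValid) (f : StateVec ι) :
    Layer.act (L.map Gate.inv) (Layer.act L f) = f := by
  induction L generalizing f with
  | nil => rfl
  | cons g L ih =>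
    have h := List.pairwise_cons.1 hL
    rw [Layer.act_cons, Layer.act_gate_comm h.1, List.map_cons, Layer.act_cons, Gate.inv_act_act,
      ih h.2]

theorem Layer.IsValid.inv {L : Layer ι} (hL : L.IsValid) : Layer.IsValid (L.map Gate.inv) := by
  unfold Layer.IsValid at *
  rw [List.pairwise_map]
  exact hL

theorem Circuit.IsDepth.inv {C : Circuit ι} {d : ℕ} (hC : C.IsDepth d) : C.inv.IsDepth d where
  length_le := by simpa [Circuit.inv] using hC.length_le
  valid L hL := by
    obtain ⟨M, hM, rfl⟩ := Circuit.mem_inv.1 hL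
    exact (hC.valid M hM).inv

theorem Circuit.act_inv_act {C : Circuit ι} (hC : ∀ L ∈ C, Layer.IsValid L) (f : StateVec ι) :
    Layer.act C.inv.flatten (Layer.act C.flatten f) = f := by
  induction C generalizing f with
  | nil => rfl
  | cons L C ih =>
    have e : Circuit.inv (L :: C) = Circuit.inv C ++ [L.map Gate.inv] := by simp [Circuit.inv]
    rw [e, List.flatten_append, Layer.act_append, List.flatten_cons (l := L), Layer.act_append,
      ih fun M hM => hC M (by simp [hM])]
    simpa using (hC L (by simp)).act_inv_act f

theorem Gate.overwrite_eq_of_notMem {g : Gate ι} {A : Set ι} (hg : g.fst ∉ A ∧ g.snd ∉ A)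
    (x : ι → Fin 2) (p : Fin 2 × Fin 2) {q : ι} (hq : q ∈ A) : g.overwrite x p q = x q :=
  g.overwrite_of_ne x p (fun h => hg.1 (h ▸ hq)) (fun h => hg.2 (h ▸ hq))

/-- Gates away from `A` commute with the multiplication by a function of the bits on `A`. -/
theorem Layer.Avoids.act_mul {L : Layer ι} {A : Set ι} (hL : L.Avoids A)
    {h : (ι → Fin 2) → ℂ} (hh : DependsOn h A) (f : StateVec ι) :
    Layer.act L (h * f) = h * Layer.act L f := by
  induction L generalizing f with
  | nil => rfl
  | cons g L ih =>
    have e : g.act (h * f) = h * g.act f := by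
      funext x
      simp only [Gate.act, Pi.mul_apply, Finset.mul_sum]
      refine Finset.sum_congr rfl fun p _ => ?_
      rw [hh fun q hq => Gate.overwrite_eq_of_notMem (hL g (by simp)) x p hq]
      ring
    rw [Layer.act_cons, e, ih fun g hg => hL g (by simp [hg]), Layer.act_cons]

theorem Layer.Avoids.dependsOn_act {L : Layer ι} {A : Set ι} (hL : L.Avoids A)
    {f : StateVec ι} (hf : DependsOn f Aᶜ) : DependsOn (Layer.act L f) Aᶜ := by
  induction L generalizing f with
  | nil => exact hf
  | cons g L ih =>
    refine ih (fun g hg => hL g (by simp [hg])) ?_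
    have hg := hL g (by simp)
    intro x y hxy
    simp only [Gate.act, hxy _ hg.1, hxy _ hg.2]
    refine Finset.sum_congr rfl fun p _ => congrArg _ (hf fun q hq => ?_)
    simp only [Gate.overwrite_apply, hxy q hq]

/-- The vector `f` has the qubits in `A` in the state `|0⟩`. -/
def Vanishes (A : Set ι) (f : StateVec ι) : Prop :=
  ∀ x, f x ≠ 0 → ∀ q ∈ A, x q = 0

theorem Layer.Avoids.vanishes_act {L : Layer ι} {A : Set ι} (hL : L.Avoids A)
    {f : StateVec ι} (hf : Vanishes A f) : Vanishes A (Layer.act L f) := by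
  classical
  have hh : DependsOn (fun x : ι → Fin 2 => if ∀ q ∈ A, x q = 0 then (1 : ℂ) else 0) A := by
    intro x y hxy
    have : (∀ q ∈ A, x q = 0) ↔ ∀ q ∈ A, y q = 0 :=
      forall₂_congr fun q hq => by rw [hxy q hq]
    simp only [this]
  have e : (fun x : ι → Fin 2 => if ∀ q ∈ A, x q = 0 then (1 : ℂ) else 0) * f = f := by
    funext x
    by_cases hx : f x = 0
    · simp [hx]
    · simp [if_pos (hf x hx)]
  intro x hx
  rw [← e, hL.act_mul hh] at hx
  by_contra hcon
  exact hx (by simp only [Pi.mul_apply, if_neg hcon, zero_mul])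

end Action

/-! ### Circuits as unitary operators -/

section Operators

variable [DecidableEq ι] [Fintype ι]

theorem Gate.op_mulVec (g : Gate ι) (f : StateVec ι) : g.op *ᵥ f = g.act f := by
  funext x
  rw [Matrix.mulVec, dotProduct, Gate.act]
  symm
  refine Finset.sum_of_injOn (g.overwrite x) ?_ (by simp [Set.MapsTo]) ?_ ?_
  · intro p _ r _ hpr
    exact Prod.ext (by simpa using congrFun hpr g.fst) (by simpa using congrFun hpr g.snd)
  · intro y _ hy
    rw [Gate.op, Matrix.of_apply, if_neg, zero_mul]
    intro hxy
    refine hy ⟨(y g.fst, y g.snd), by simp, ?_⟩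
    funext q
    rw [Gate.overwrite_apply]
    split_ifs with h1 h2
    · rw [h1]
    · rw [h2]
    · exact hxy q h2 h1
  · intro p _
    rw [Gate.op, Matrix.of_apply, if_pos fun q h1 h2 => (g.overwrite_of_ne x p h1 h2).symm]
    simp

theorem Layer.op_mulVec (L : Layer ι) (f : StateVec ι) : L.op *ᵥ f = L.act f := by
  induction L generalizing f with
  | nil => simp [Layer.op]
  | cons g L ih => rw [Layer.op, ← Matrix.mulVec_mulVec, ih, Gate.op_mulVec, Layer.act_cons]

theorem Circuit.op_mulVec (C : Circuit ι) (f : StateVec ι) :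
    C.op *ᵥ f = Layer.act C.flatten f := by
  induction C generalizing f with
  | nil => simp [Circuit.op]
  | cons L C ih =>
    rw [Circuit.op, ← Matrix.mulVec_mulVec, ih, Layer.op_mulVec, List.flatten_cons,
      Layer.act_append]

theorem Gate.conjTranspose_op (g : Gate ι) : g.opᴴ = g.inv.op := by
  ext x y
  have e : (g.mat⁻¹).1 = g.mat.1ᴴ := rfl
  have c : (∀ q, q ≠ g.fst → q ≠ g.snd → y q = x q) ↔
      ∀ q, q ≠ g.fst → q ≠ g.snd → x q = y q :=
    forall_congr' fun q => imp_congr_right fun _ => imp_congr_right fun _ => eq_comm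
  simp only [Matrix.conjTranspose_apply, Gate.op, Gate.inv, Matrix.of_apply, e, c]
  split_ifs <;> simp

theorem isState_iff {f : StateVec ι} : IsState f ↔ star f ⬝ᵥ f = 1 := by
  have : star f ⬝ᵥ f = ((∑ x, ‖f x‖ ^ 2 : ℝ) : ℂ) := by
    simp [dotProduct, Complex.conj_mul']
  rw [this, IsState, Complex.ofReal_eq_one]

theorem IsState.gate_act {f : StateVec ι} (hf : IsState f) (g : Gate ι) :
    IsState (g.act f) := by
  rw [isState_iff] at *
  rw [← Gate.op_mulVec, Matrix.star_mulVec, ← Matrix.dotProduct_mulVec, Gate.conjTranspose_op,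
    Gate.op_mulVec, Gate.op_mulVec, Gate.inv_act_act, hf]

theorem IsState.act {f : StateVec ι} (hf : IsState f) (L : Layer ι) : IsState (L.act f) := by
  induction L generalizing f with
  | nil => exact hf
  | cons g L ih => exact ih (hf.gate_act g)

theorem isState_zeroState : IsState (zeroState ι) := by
  rw [IsState, Finset.sum_eq_single 0] <;> simp +contextual [zeroState]

/-- A state with `|0⟩` on `A` is `|0⟩_A ⊗ φ` for some state `φ`. -/
theorem exists_eq_zeroOn {A : Finset ι} {f : StateVec ι} (hf : IsState f)
    (hA : Vanishes (A : Set ι) f) :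
    ∃ φ : StateVec {q : ι // q ∉ A}, IsState φ ∧ f = zeroOn A φ := by
  let ext (y : {q : ι // q ∉ A} → Fin 2) : ι → Fin 2 := fun q => if h : q ∉ A then y ⟨q, h⟩ else 0
  have hext : ∀ x : ι → Fin 2, (∀ q ∈ A, x q = 0) → ext (fun q => x q.1) = x := by
    intro x hx
    funext q
    by_cases hq : q ∈ A
    · simp [ext, hq, hx q hq]
    · simp [ext, hq]
  refine ⟨fun y => f (ext y), ?_, ?_⟩
  · rw [IsState] at *
    rw [← hf]
    refine Finset.sum_of_injOn ext ?_ (by simp [Set.MapsTo]) ?_ fun _ _ => rfl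
    · intro y _ z _ hyz
      funext q
      have := congrFun hyz q.1
      simpa [ext, q.2] using this
    · intro x _ hx
      by_contra hne
      have hx0 : f x ≠ 0 := fun h => hne (by simp [h])
      exact hx ⟨fun q => x q.1, by simp, hext x (hA x hx0)⟩
  · funext x
    rw [zeroOn]
    split_ifs with h
    · rw [hext x h]
    · by_contra hne
      exact h (hA x hne)

theorem vanishes_zeroOn (A : Finset ι) (φ : StateVec {q : ι // q ∉ A}) :
    Vanishes (A : Set ι) (zeroOn A φ) := by
  intro x hx
  by_contra h
  exact hx (if_neg h)

/-- If `ψ` and `ψ ⊗ χ` are states, so is `χ`. -/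
theorem IsState.of_tensor {α β : Type*} [Fintype α] [DecidableEq α] [Fintype β] [DecidableEq β]
    {φ : StateVec α} {χ : StateVec β} (hφ : IsState φ) (h : IsState (tensor φ χ)) :
    IsState χ := by
  rw [IsState, ← (Equiv.sumArrowEquivProdArrow α β (Fin 2)).symm.sum_comp,
    Fintype.sum_prod_type] at h
  have e : ∀ (x : α → Fin 2) (y : β → Fin 2),
      ‖tensor φ χ ((Equiv.sumArrowEquivProdArrow α β (Fin 2)).symm (x, y))‖ ^ 2
        = ‖φ x‖ ^ 2 * ‖χ y‖ ^ 2 := by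
    intro x y
    rw [← mul_pow, ← norm_mul]
    rfl
  simp only [e, ← Finset.mul_sum, ← Finset.sum_mul] at h
  rw [IsState] at *
  rwa [hφ, one_mul] at h

end Operators

/-! ### Lightcones in circuits without resets -/

section Cone

variable [DecidableEq ι] [DecidableEq κ]

open ResetCircuit

theorem mem_greenGates {L : Layer ι} {B : Finset ι} {g : Gate ι} :
    g ∈ greenGates L B ↔ g ∈ L ∧ (g.fst ∈ B ∨ g.snd ∈ B) := by
  simp [greenGates]

theorem mem_blue_gates {A : Finset ι} {L : Layer ι} {W : ResetCircuit ι} {q : ι} :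
    q ∈ blue A (.gates L :: W) ↔
      q ∈ blue A W ∨ ∃ g ∈ greenGates L (blue A W), q ∈ g.support := by
  have h : ∀ l : Layer ι,
      q ∈ (l.map Gate.support).foldr (· ∪ ·) ∅ ↔ ∃ g ∈ l, q ∈ g.support := by
    intro l
    induction l with
    | nil => simp
    | cons g l ih => simp [ih]
  rw [blue, Finset.mem_union, h]

/-- The backward lightcone of the outputs `A` in a circuit without resets. -/
def Circuit.cone (A : Finset ι) : Circuit ι → Circuit ι
  | [] => []
  | L :: K => greenGates L (blue A (List.map Step.gates K)) :: cone A K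

theorem Circuit.length_cone (A : Finset ι) (K : Circuit ι) : (K.cone A).length = K.length := by
  induction K with
  | nil => rfl
  | cons L K ih => simp [Circuit.cone, ih]

theorem Circuit.cone_sublist {A : Finset ι} {K : Circuit ι} {L : Layer ι} (hL : L ∈ K.cone A) :
    ∃ M ∈ K, List.Sublist L M := by
  induction K with
  | nil => simp [Circuit.cone] at hL
  | cons M K ih =>
    rcases List.mem_cons.1 hL with rfl | hL
    · exact ⟨M, by simp, List.filter_sublist⟩
    · obtain ⟨M', hM', h⟩ := ih hL
      exact ⟨M', by simp [hM'], h⟩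

theorem Circuit.valid_cone {A : Finset ι} {K : Circuit ι} (hK : ∀ L ∈ K, Layer.IsValid L) :
    ∀ L ∈ K.cone A, Layer.IsValid L := by
  intro L hL
  obtain ⟨M, hM, h⟩ := Circuit.cone_sublist hL
  exact List.Pairwise.sublist h (hK M hM)

theorem Circuit.subset_blue (A : Finset ι) (K : Circuit ι) : A ⊆ blue A (List.map Step.gates K) := by
  induction K with
  | nil => exact subset_rfl
  | cons L K ih => exact fun q hq => mem_blue_gates.2 (Or.inl (ih hq))

theorem Circuit.support_subset_blue {A : Finset ι} {K : Circuit ι} {L : Layer ι}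
    (hL : L ∈ K.cone A) {g : Gate ι} (hg : g ∈ L) :
    g.support ⊆ blue A (List.map Step.gates K) := by
  induction K with
  | nil => simp [Circuit.cone] at hL
  | cons M K ih =>
    rcases List.mem_cons.1 hL with rfl | hL
    · exact fun q hq => mem_blue_gates.2 (Or.inr ⟨g, hg, hq⟩)
    · exact fun q hq => mem_blue_gates.2 (Or.inl (ih hL hq))

/-- A circuit differs from its backward lightcone of `A` only by subsequent gates that do not
touch `A`: a gate outside the lightcone commutes with the part of the lightcone above it. -/
theorem Circuit.exists_cone_eq (A : Finset ι) {K : Circuit ι}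
    (hK : ∀ L ∈ K, Layer.IsValid L) :
    ∃ N : Layer ι, N.Avoids A ∧
      ∀ f, Layer.act (K.cone A).flatten f = Layer.act N (Layer.act K.flatten f) := by
  induction K with
  | nil => exact ⟨[], by simp [Layer.Avoids], fun f => rfl⟩
  | cons L K ih =>
    obtain ⟨N, hN, h⟩ := ih fun M hM => hK M (by simp [hM])
    set B := blue A (List.map Step.gates K) with hB
    let p : Gate ι → Bool := fun g => decide (g.fst ∈ B ∨ g.snd ∈ B)
    let M : Layer ι := L.filter fun g => !p g
    have hM : M.Avoids (B : Set ι) := by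
      intro g hg
      simpa [p] using (List.mem_filter.1 hg).2
    have hMA : M.Avoids (A : Set ι) := fun g hg =>
      ⟨fun hq => (hM g hg).1 (Circuit.subset_blue A K hq),
        fun hq => (hM g hg).2 (Circuit.subset_blue A K hq)⟩
    have hL : ∀ f, Layer.act L f = Layer.act M (Layer.act (greenGates L B) f) :=
      Layer.act_eq_act_filter p fun g hg g' hg' hpg hpg' =>
        (hK L (by simp)).disjoint hg hg' fun e => by simp [e, hpg'] at hpg
    refine ⟨N ++ (M.map Gate.inv).reverse, hN.append hMA.reverse_inv, fun f => ?_⟩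
    have hcomm : ∀ f, Layer.act (M.map Gate.inv).reverse (Layer.act (Circuit.cone A K).flatten f) =
        Layer.act (Circuit.cone A K).flatten (Layer.act (M.map Gate.inv).reverse f) := by
      refine Layer.act_comm fun g hg g' hg' => ?_
      obtain ⟨L', hL', hg'⟩ := List.mem_flatten.1 hg'
      have hsub := Circuit.support_subset_blue hL' hg'
      rw [Finset.disjoint_left]
      intro q hq hq'
      have := hM.reverse_inv g hg
      rcases Gate.mem_support.1 hq with rfl | rfl
      · exact this.1 (hsub hq')
      · exact this.2 (hsub hq')
    have hstep : Layer.act (greenGates L B) f =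
        Layer.act (M.map Gate.inv).reverse (Layer.act L f) := by
      rw [hL, Layer.act_reverse_inv_act]
    rw [Circuit.cone, List.flatten_cons, Layer.act_append, ← hB, hstep, ← hcomm, h,
      List.flatten_cons, Layer.act_append, Layer.act_append]

end Cone

/-! ### The wire diagram of a circuit with resets -/

section Diagram

variable [DecidableEq ι] [DecidableEq κ]

open ResetCircuit

/-- All gates of `W`, layer by layer, as gates on the wires of the diagram of `W`. -/
def ResetCircuit.diagram : ResetCircuit ι → Circuit (ι × ℕ)
  | [] => []
  | .gates L :: W => L.map (Gate.map (wire W)) :: diagram W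
  | .reset _ :: W => diagram W

theorem Gate.mem_support_map {e : ι ↪ κ} {g : Gate ι} {w : κ} :
    w ∈ (g.map e).support ↔ ∃ q ∈ g.support, e q = w := by
  simp [Gate.support, Gate.map, eq_comm]

theorem Gate.disjoint_support_map {e : ι ↪ κ} {g h : Gate ι} :
    Disjoint (g.map e).support (h.map e).support ↔ Disjoint g.support h.support := by
  simp [Gate.support, Gate.map]

theorem Layer.isValid_map {e : ι ↪ κ} {L : Layer ι} :
    Layer.IsValid (L.map (Gate.map e)) ↔ L.IsValid := by
  simp only [Layer.IsValid, List.pairwise_map, Gate.disjoint_support_map]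

theorem ResetCircuit.le_resetCount {A : Finset ι} {W : ResetCircuit ι} {q : ι} {s : ℕ}
    (h : (q, s) ∈ lightconeWires A W) :
    s ≤ resetCount W q ∧ (s = resetCount W q → q ∈ blue A W) := by
  have new : ∀ {W : ResetCircuit ι}, (q, s) ∈ (blue A W).map (wire W) →
      s ≤ resetCount W q ∧ (s = resetCount W q → q ∈ blue A W) := by
    intro W h
    obtain ⟨r, hr, e⟩ := Finset.mem_map.1 h
    obtain ⟨rfl, rfl⟩ := Prod.mk.inj e
    exact ⟨le_rfl, fun _ => hr⟩
  induction W with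
  | nil => exact new h
  | cons t W ih =>
    rcases Finset.mem_union.1 h with h | h
    · obtain ⟨h1, h2⟩ := ih h
      cases t with
      | gates L => exact ⟨h1, fun e => mem_blue_gates.2 (Or.inl (h2 e))⟩
      | reset R =>
        by_cases hq : q ∈ R
        · simp only [resetCount, if_pos hq]
          exact ⟨by omega, fun _ => by omega⟩
        · simp only [resetCount, if_neg hq, blue, Finset.mem_sdiff]
          exact ⟨h1, fun e => ⟨h2 e, hq⟩⟩
    · exact new h

theorem ResetCircuit.wire_mem_lightconeWires {A : Finset ι} {W : ResetCircuit ι} {q : ι} :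
    wire W q ∈ lightconeWires A W ↔ q ∈ blue A W := by
  refine ⟨fun h => (le_resetCount h).2 rfl, fun h => ?_⟩
  cases W with
  | nil => exact Finset.mem_map_of_mem _ h
  | cons t W => exact Finset.mem_union_right _ (Finset.mem_map_of_mem _ h)

theorem ResetCircuit.greenGates_map_wire (A : Finset ι) (L : Layer ι) (W : ResetCircuit ι) :
    greenGates (L.map (Gate.map (wire W))) (lightconeWires A W) =
      (greenGates L (blue A W)).map (Gate.map (wire W)) := by
  rw [greenGates, greenGates, List.filter_map]
  congr 1
  refine List.filter_congr fun g _ => ?_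
  simp [Gate.map, wire_mem_lightconeWires]

/-- The wires of the backward lightcone of `W` are the blue wires of its diagram. -/
theorem ResetCircuit.lightconeWires_eq_blue (A : Finset ι) (W : ResetCircuit ι) :
    lightconeWires A W = blue (A.map (wire [])) (List.map Step.gates W.diagram) := by
  induction W with
  | nil => rfl
  | cons t W ih =>
    cases t with
    | gates L =>
      ext w
      rw [diagram, List.map_cons, mem_blue_gates, ← ih, greenGates_map_wire, lightconeWires,
        Finset.mem_union]
      constructor
      · rintro (h | h)
        · exact Or.inl h
        · obtain ⟨q, hq, rfl⟩ := Finset.mem_map.1 h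
          rcases mem_blue_gates.1 hq with hq | ⟨g, hg, hq⟩
          · exact Or.inl (wire_mem_lightconeWires.2 hq)
          · exact Or.inr ⟨g.map (wire W), List.mem_map_of_mem hg,
              Gate.mem_support_map.2 ⟨q, hq, rfl⟩⟩
      · rintro (h | ⟨g, hg, h⟩)
        · exact Or.inl h
        · obtain ⟨g', hg', rfl⟩ := List.mem_map.1 hg
          obtain ⟨q, hq, rfl⟩ := Gate.mem_support_map.1 h
          exact Or.inr (Finset.mem_map_of_mem _ (mem_blue_gates.2 (Or.inr ⟨g', hg', hq⟩)))
    | reset R =>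
      rw [diagram, ← ih, lightconeWires, Finset.union_eq_left]
      intro w hw
      obtain ⟨q, hq, rfl⟩ := Finset.mem_map.1 hw
      obtain ⟨hq, hR⟩ := Finset.mem_sdiff.1 hq
      have e : wire (.reset R :: W) q = wire W q := by
        change (q, _) = (q, _)
        simp [resetCount, hR]
      rw [e]
      exact wire_mem_lightconeWires.2 hq

/-- The backward lightcone of `W` is that of its diagram, which is a circuit without resets. -/
theorem ResetCircuit.greenLayers_eq_cone (A : Finset ι) (W : ResetCircuit ι) :
    greenLayers A W = W.diagram.cone (A.map (wire [])) := by
  induction W with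
  | nil => rfl
  | cons t W ih =>
    cases t with
    | gates L =>
      rw [greenLayers, diagram, Circuit.cone, ih, ← lightconeWires_eq_blue, greenGates_map_wire]
    | reset R => rw [greenLayers, diagram, ih]

theorem ResetCircuit.valid_diagram {W : ResetCircuit ι}
    (hW : ∀ L : Layer ι, Step.gates L ∈ W → L.IsValid) : ∀ L ∈ W.diagram, Layer.IsValid L := by
  induction W with
  | nil => simp [diagram]
  | cons t W ih =>
    have ih := ih fun L hL => hW L (by simp [hL])
    cases t with
    | gates L =>
      intro M hM
      rcases List.mem_cons.1 hM with rfl | hM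
      · exact Layer.isValid_map.2 (hW L (by simp))
      · exact ih M hM
    | reset R => exact ih

/-! ### Runs in which every reset finds its qubits in the state zero -/

/-- The gates of `W` take `f` to `f'`, and every reset of `W` finds its qubits in the state `|0⟩`,
so that it does nothing. -/
def ResetCircuit.CleanRun : ResetCircuit ι → StateVec ι → StateVec ι → Prop
  | [], f, f' => f = f'
  | .gates L :: W, f, f' => CleanRun W (Layer.act L f) f'
  | .reset R :: W, f, f' => Vanishes (R : Set ι) f ∧ CleanRun W f f'

theorem ResetCircuit.CleanRun.append {W W' : ResetCircuit ι} {f g h : StateVec ι}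
    (H : W.CleanRun f g) (H' : W'.CleanRun g h) : CleanRun (W ++ W') f h := by
  induction W generalizing f with
  | nil => exact (show f = g from H) ▸ H'
  | cons t W ih =>
    cases t with
    | gates L => exact ih H
    | reset R => exact ⟨H.1, ih H.2⟩

theorem ResetCircuit.cleanRun_gates (K : Circuit ι) (f : StateVec ι) :
    CleanRun (List.map Step.gates K) f (Layer.act K.flatten f) := by
  induction K generalizing f with
  | nil => exact rfl
  | cons L K ih => simpa [CleanRun] using ih (Layer.act L f)

theorem resetChannel_pureState [Fintype ι] {R : Finset ι} {f : StateVec ι}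
    (hf : Vanishes (R : Set ι) f) : resetChannel R (pureState f) = pureState f := by
  ext x y
  have hfill : ∀ x : ι → Fin 2, (∀ q ∈ R, x q = 0) → fill R 0 x = x := by
    intro x hx
    funext q
    by_cases hq : q ∈ R
    · simp [fill, hq, hx q hq]
    · simp [fill, hq]
  simp only [resetChannel, Matrix.of_apply, pureState, Matrix.vecMulVec_apply, Pi.star_apply]
  split_ifs with h
  · rw [Finset.sum_eq_single 0]
    · rw [hfill x fun q hq => (h q hq).1, hfill y fun q hq => (h q hq).2]
    · intro z _ hz
      have : f (fill R z x) = 0 := by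
        by_contra hne
        refine hz (funext fun q => ?_)
        simpa [fill] using hf _ hne q.1 q.2
      rw [this, zero_mul]
    · simp
  · by_contra hne
    refine h fun q hq => ⟨hf x ?_ q hq, hf y ?_ q hq⟩
    · rintro e
      simp [e] at hne
    · rintro e
      simp [e] at hne

theorem ResetCircuit.CleanRun.channel_pureState [Fintype ι] {W : ResetCircuit ι}
    {f f' : StateVec ι} (H : W.CleanRun f f') : W.channel (pureState f) = pureState f' := by
  induction W generalizing f with
  | nil => exact congrArg pureState H
  | cons t W ih =>
    cases t with
    | gates L =>
      rw [channel, Step.channel, ← ih H]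
      congr 1
      rw [pureState, pureState, Matrix.mul_vecMulVec, Matrix.vecMulVec_mul, ← Layer.op_mulVec,
        Matrix.star_mulVec]
    | reset R => rw [channel, Step.channel, resetChannel_pureState H.1, ih H.2]

open Classical in
/-- The vector `f` on the qubits in the range of `e`, with all other qubits in the state `|0⟩`. -/
noncomputable def embed (e : ι ↪ κ) (f : StateVec ι) : StateVec κ :=
  fun x => if ∀ k ∉ Set.range e, x k = 0 then f (x ∘ e) else 0

theorem Gate.overwrite_map_comp (e : ι ↪ κ) (g : Gate ι) (x : κ → Fin 2) (p : Fin 2 × Fin 2) :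
    (g.map e).overwrite x p ∘ e = g.overwrite (x ∘ e) p := by
  funext q
  simp [Gate.overwrite_apply, Gate.map]

omit [DecidableEq ι] in
theorem Gate.overwrite_map_of_notMem (e : ι ↪ κ) (g : Gate ι) (x : κ → Fin 2)
    (p : Fin 2 × Fin 2) {k : κ} (hk : k ∉ Set.range e) : (g.map e).overwrite x p k = x k :=
  (g.map e).overwrite_of_ne x p (fun h => hk ⟨_, h.symm⟩) (fun h => hk ⟨_, h.symm⟩)

theorem Gate.act_map_embed (e : ι ↪ κ) (g : Gate ι) (f : StateVec ι) :
    (g.map e).act (embed e f) = embed e (g.act f) := by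
  funext x
  have h : ∀ p, (∀ k ∉ Set.range e, (g.map e).overwrite x p k = 0) ↔
      ∀ k ∉ Set.range e, x k = 0 := fun p =>
    forall₂_congr fun k hk => by rw [Gate.overwrite_map_of_notMem e g x p hk]
  by_cases hx : ∀ k ∉ Set.range e, x k = 0
  · rw [embed, if_pos hx, Gate.act, Gate.act]
    refine Finset.sum_congr rfl fun p _ => ?_
    rw [embed, if_pos ((h p).2 hx), Gate.overwrite_map_comp]
    rfl
  · rw [embed, if_neg hx, Gate.act]
    refine Finset.sum_eq_zero fun p _ => ?_
    rw [embed, if_neg (mt (h p).1 hx), mul_zero]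

theorem Layer.act_map_embed (e : ι ↪ κ) (L : Layer ι) (f : StateVec ι) :
    Layer.act (L.map (Gate.map e)) (embed e f) = embed e (L.act f) := by
  induction L generalizing f with
  | nil => rfl
  | cons g L ih => rw [List.map_cons, Layer.act_cons, Gate.act_map_embed, ih, Layer.act_cons]

/-- A reset of qubits in the state `|0⟩` passes from their old wires to fresh wires, which are also
in the state `|0⟩`; so the state of all wires stays the same. -/
theorem embed_wire_reset {R : Finset ι} (W : ResetCircuit ι) {f : StateVec ι}
    (hf : Vanishes (R : Set ι) f) :
    embed (wire (.reset R :: W)) f = embed (wire W) f := by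
  have e : ∀ q ∉ R, wire (.reset R :: W) q = wire W q := fun q hq => by
    change (q, _) = (q, _)
    simp [resetCount, hq]
  -- each of the two vectors is the restriction of `f` to the wires of the qubits outside `R`
  have key : ∀ W₁ W₂ : ResetCircuit ι, (∀ q ∉ R, wire W₁ q = wire W₂ q) → ∀ x,
      embed (wire W₁) f x ≠ 0 → embed (wire W₂) f x = embed (wire W₁) f x := by
    intro W₁ W₂ e x hx
    have hx1 : ∀ k ∉ Set.range (wire W₁), x k = 0 := by
      by_contra hcon
      exact hx (if_neg hcon)
    have hx2 : f (x ∘ wire W₁) ≠ 0 := by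
      rwa [embed, if_pos hx1] at hx
    have hx3 : ∀ k, (∀ q ∉ R, wire W₁ q ≠ k) → x k = 0 := by
      intro k hk
      by_cases hk' : k ∈ Set.range (wire W₁)
      · obtain ⟨q, rfl⟩ := hk'
        by_cases hq : q ∈ R
        · exact hf _ hx2 q hq
        · exact absurd rfl (hk q hq)
      · exact hx1 k hk'
    have hx4 : ∀ k ∉ Set.range (wire W₂), x k = 0 := fun k hk =>
      hx3 k fun q hq h => hk ⟨q, by rw [← e q hq, h]⟩
    have hx5 : x ∘ wire W₂ = x ∘ wire W₁ := by
      funext q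
      by_cases hq : q ∈ R
      · refine Eq.trans (hx3 _ fun r hr h => hr ?_) (hf _ hx2 q hq).symm
        have h' : r = q := congrArg Prod.fst h
        rwa [h']
      · exact congrArg x (e q hq).symm
    rw [embed, embed, if_pos hx1, if_pos hx4, hx5]
  funext x
  by_cases hx : embed (wire W) f x = 0
  · by_contra hne
    exact hne (key _ _ e x (by rwa [hx] at hne)).symm
  · exact key _ _ (fun q hq => (e q hq).symm) x hx

theorem ResetCircuit.CleanRun.act_diagram {W : ResetCircuit ι} {f f' : StateVec ι}
    (H : W.CleanRun f f') :
    Layer.act W.diagram.flatten (embed (wire W) f) = embed (wire []) f' := by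
  induction W generalizing f with
  | nil => exact congrArg (embed (wire [])) H
  | cons t W ih =>
    cases t with
    | gates L =>
      rw [diagram, List.flatten_cons, Layer.act_append, ← ih H, ← Layer.act_map_embed]
      rfl
    | reset R => rw [diagram, embed_wire_reset W H.1, ih H.2]

end Diagram

/-! ### Spreading of lightcones -/

section Spread

variable [DecidableEq ι]

open ResetCircuit

/-- The number of layers of gates of a circuit with resets. -/
def ResetCircuit.gateDepth : ResetCircuit ι → ℕ
  | [] => 0
  | .gates _ :: W => gateDepth W + 1
  | .reset _ :: W => gateDepth W

omit [DecidableEq ι] in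
theorem ResetCircuit.gateDepth_append (W W' : ResetCircuit ι) :
    gateDepth (W ++ W') = gateDepth W + gateDepth W' := by
  induction W with
  | nil => simp [gateDepth]
  | cons t W ih => cases t <;> simp [gateDepth, ih]; omega

omit [DecidableEq ι] in
theorem ResetCircuit.gateDepth_gates (K : Circuit ι) :
    gateDepth (List.map Step.gates K) = K.length := by
  induction K with
  | nil => rfl
  | cons L K ih => simp [gateDepth, ih]

theorem ResetCircuit.length_greenLayers (A : Finset ι) (W : ResetCircuit ι) :
    (greenLayers A W).length = gateDepth W := by
  induction W with
  | nil => rfl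
  | cons t W ih => cases t <;> simp [greenLayers, gateDepth, ih]

theorem ResetCircuit.blue_append (A : Finset ι) (W W' : ResetCircuit ι) :
    blue A (W ++ W') = blue (blue A W') W := by
  induction W with
  | nil => rfl
  | cons t W ih => cases t <;> simp [blue, ih]

theorem ResetCircuit.mem_blue_iff {A : Finset ι} {W : ResetCircuit ι} {q : ι} :
    q ∈ blue A W ↔ ∃ a ∈ A, q ∈ blue {a} W := by
  induction W generalizing q with
  | nil => simp [blue]
  | cons t W ih =>
    cases t with
    | gates L =>
      simp only [mem_blue_gates, mem_greenGates]
      constructor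
      · rintro (h | ⟨g, ⟨hg, h | h⟩, hq⟩)
        · obtain ⟨a, ha, h⟩ := ih.1 h
          exact ⟨a, ha, Or.inl h⟩
        · obtain ⟨a, ha, h⟩ := ih.1 h
          exact ⟨a, ha, Or.inr ⟨g, ⟨hg, Or.inl h⟩, hq⟩⟩
        · obtain ⟨a, ha, h⟩ := ih.1 h
          exact ⟨a, ha, Or.inr ⟨g, ⟨hg, Or.inr h⟩, hq⟩⟩
      · rintro ⟨a, ha, h | ⟨g, ⟨hg, h | h⟩, hq⟩⟩
        · exact Or.inl (ih.2 ⟨a, ha, h⟩)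
        · exact Or.inr ⟨g, ⟨hg, Or.inl (ih.2 ⟨a, ha, h⟩)⟩, hq⟩
        · exact Or.inr ⟨g, ⟨hg, Or.inr (ih.2 ⟨a, ha, h⟩)⟩, hq⟩
    | reset R =>
      simp only [blue, Finset.mem_sdiff, ih]
      aesop

theorem ResetCircuit.blue_empty (W : ResetCircuit ι) : blue ∅ W = ∅ := by
  ext q
  rw [mem_blue_iff]
  simp

/-- The lightcone spreads by at most one lattice step per layer of nearest-neighbour gates. -/
theorem ResetCircuit.exists_edist_le_of_mem_blue {G : SimpleGraph ι} {A : Finset ι}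
    {W : ResetCircuit ι} (hW : ∀ L : Layer ι, Step.gates L ∈ W → ∀ g ∈ L, G.Adj g.fst g.snd)
    {q : ι} (hq : q ∈ blue A W) : ∃ a ∈ A, G.edist a q ≤ (gateDepth W : ℕ∞) := by
  induction W generalizing q with
  | nil => exact ⟨q, hq, by simp⟩
  | cons t W ih =>
    have ih := @ih fun L hL => hW L (by simp [hL])
    cases t with
    | gates L =>
      have near : ∀ r ∈ blue A W, G.edist r q ≤ 1 →
          ∃ a ∈ A, G.edist a q ≤ (gateDepth (.gates L :: W) : ℕ∞) := by
        intro r hr hrq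
        obtain ⟨a, ha, har⟩ := ih hr
        refine ⟨a, ha, (G.edist_triangle (v := r)).trans ?_⟩
        rw [gateDepth, Nat.cast_add, Nat.cast_one]
        exact add_le_add har hrq
      rcases mem_blue_gates.1 hq with h | ⟨g, hg, hqg⟩
      · exact near q h (by simp)
      · obtain ⟨hg, h⟩ := mem_greenGates.1 hg
        have hadj := hW L (by simp) g hg
        have h1 : G.edist g.fst g.snd ≤ 1 := by simpa using hadj.toWalk.edist_le
        have h2 : G.edist g.snd g.fst ≤ 1 := by simpa using hadj.symm.toWalk.edist_le
        rcases Gate.mem_support.1 hqg with rfl | rfl <;> rcases h with h | h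
        · exact near _ h (by simp)
        · exact near _ h h2
        · exact near _ h h1
        · exact near _ h (by simp)
    | reset R => exact ih (Finset.mem_sdiff.1 hq).1

omit [DecidableEq ι] in
theorem mem_ball [Fintype ι] {G : SimpleGraph ι} {A : Finset ι} {r : ℕ} {v : ι} :
    v ∈ ball G A r ↔ ∃ a ∈ A, G.edist a v ≤ (r : ℕ∞) := by
  simp [ball]

omit [DecidableEq ι] in
theorem subset_ball [Fintype ι] (G : SimpleGraph ι) (A : Finset ι) (r : ℕ) : A ⊆ ball G A r :=
  fun v hv => mem_ball.2 ⟨v, hv, by simp⟩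

/-- The backward lightcone of `A` in `U†` is a local inversion of `A` for `U|0…0⟩`: it is `U†`
followed by gates that do not touch `A`. -/
theorem exists_isLocalInversion [Fintype ι] {G : SimpleGraph ι} {U : Circuit ι} {d : ℕ}
    (hU : U.IsDepth d) (hUloc : U.IsLocal G) (A : Finset ι) :
    ∃ V, IsLocalInversion G (U.op *ᵥ zeroState ι) A d V := by
  obtain ⟨N, hN, h⟩ := Circuit.exists_cone_eq A hU.inv.valid
  refine ⟨U.inv.cone A, ⟨?_, Circuit.valid_cone hU.inv.valid⟩, ?_, ?_, ?_⟩
  · rw [Circuit.length_cone]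
    exact hU.inv.length_le
  · intro L hL g hg
    obtain ⟨M, hM, hLM⟩ := Circuit.cone_sublist hL
    exact hUloc.inv M hM g (hLM.subset hg)
  · intro L hL g hg q hq
    obtain ⟨a, ha, haq⟩ := ResetCircuit.exists_edist_le_of_mem_blue (G := G)
      (fun L hL g hg => by
        obtain ⟨M, hM, e⟩ := List.mem_map.1 hL
        cases e
        exact hUloc.inv _ hM g hg)
      (Circuit.support_subset_blue hL hg hq)
    rw [ResetCircuit.gateDepth_gates] at haq
    exact mem_ball.2 ⟨a, ha, haq.trans (by exact_mod_cast hU.inv.length_le)⟩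
  · rw [Circuit.op_mulVec, Circuit.op_mulVec, h, Circuit.act_inv_act hU.valid]
    refine exists_eq_zeroOn (isState_zeroState.act N) (hN.vanishes_act ?_)
    intro x hx q _
    by_contra hne
    exact hx (if_neg fun h => hne (by rw [h]; rfl))

end Spread

/-! ### Circuits run in parallel -/

section Parallel

variable [DecidableEq ι] {m d : ℕ} {V : Fin m → Circuit ι} {B : Fin m → Finset ι}

omit [DecidableEq ι] in
theorem Circuit.getD_mem {C : Circuit ι} {t : ℕ} {g : Gate ι} (hg : g ∈ C.getD t []) :
    C.getD t [] ∈ C := by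
  by_cases h : t < C.length
  · rw [List.getD_eq_getElem _ _ h]
    exact List.getElem_mem h
  · rw [List.getD_eq_default _ _ (not_lt.1 h)] at hg
    simp at hg

omit [DecidableEq ι] in
theorem Circuit.mem_parallel {L : Layer ι} (hL : L ∈ parallel d V) {g : Gate ι} (hg : g ∈ L) :
    ∃ j, ∃ M ∈ V j, g ∈ M := by
  obtain ⟨t, _, rfl⟩ := List.mem_map.1 hL
  obtain ⟨j, _, hg⟩ := List.mem_flatMap.1 hg
  exact ⟨j, _, Circuit.getD_mem hg, hg⟩

theorem Circuit.valid_parallel (hV : ∀ j, ∀ L ∈ V j, Layer.IsValid L)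
    (hB : ∀ j, (V j).IsSupportedOn (B j)) (hd : Pairwise fun j j' => Disjoint (B j) (B j')) :
    ∀ L ∈ parallel d V, Layer.IsValid L := by
  intro L hL
  obtain ⟨t, _, rfl⟩ := List.mem_map.1 hL
  rw [Layer.IsValid, List.pairwise_flatMap]
  constructor
  · intro j _
    rcases List.eq_nil_or_concat ((V j).getD t []) with h | ⟨_, g, h⟩
    · rw [h]
      exact List.Pairwise.nil
    · exact hV j _ (Circuit.getD_mem (g := g) (by rw [h]; simp))
  · refine (List.nodup_finRange m).imp fun {j j'} hne g hg g' hg' => ?_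
    exact Finset.disjoint_of_subset_left (hB j _ (Circuit.getD_mem hg) g hg)
      (Finset.disjoint_of_subset_right (hB j' _ (Circuit.getD_mem hg') g' hg') (hd hne))

theorem _root_.List.flatMap_range_getD {α : Type*} (l : List (List α)) {d : ℕ}
    (h : l.length ≤ d) : (List.range d).flatMap (fun t => l.getD t []) = l.flatten := by
  induction l generalizing d with
  | nil => simp
  | cons a l ih =>
    cases d with
    | zero => simp at h
    | succ d =>
      rw [List.range_succ_eq_map, List.flatMap_cons, List.flatMap_map, List.flatten_cons]
      simp only [List.getD_cons_zero, List.getD_cons_succ]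
      rw [ih (by simpa using h)]

/-- The gates of a parallel run inside the region of the `j`-th circuit form that circuit. -/
theorem Circuit.filter_parallel (hV : ∀ j, (V j).length ≤ d)
    (hB : ∀ j, (V j).IsSupportedOn (B j)) (hd : Pairwise fun j j' => Disjoint (B j) (B j'))
    (j : Fin m) :
    (parallel d V).flatten.filter (fun g => decide (g.support ⊆ B j)) = (V j).flatten := by
  have inside : ∀ j' t, ∀ g ∈ (V j').getD t [], g.support ⊆ B j' := by
    intro j' t g hg
    exact hB j' _ (Circuit.getD_mem hg) g hg
  have hinner : ∀ t, ((List.finRange m).flatMap fun j' => (V j').getD t []).filter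
      (fun g => decide (g.support ⊆ B j)) = (V j).getD t [] := by
    intro t
    rw [List.filter_flatMap]
    have hout : ∀ j', j' ≠ j →
        ((V j').getD t []).filter (fun g => decide (g.support ⊆ B j)) = [] := by
      intro j' hne
      rw [List.filter_eq_nil_iff]
      intro g hg hsub
      have hf : g.fst ∈ g.support := Gate.mem_support.2 (Or.inl rfl)
      exact Finset.disjoint_left.1 (hd hne) (inside j' t g hg hf) (of_decide_eq_true hsub hf)
    obtain ⟨s, r, e⟩ := List.append_of_mem (List.mem_finRange j)
    have hnd := e ▸ List.nodup_finRange m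
    rw [List.nodup_middle, List.nodup_cons, List.mem_append, not_or] at hnd
    rw [e, List.flatMap_append, List.flatMap_cons,
      List.flatMap_eq_nil_iff.2 fun j' hj' => hout j' fun h => hnd.1.1 (h ▸ hj'),
      List.flatMap_eq_nil_iff.2 fun j' hj' => hout j' fun h => hnd.1.2 (h ▸ hj'),
      List.nil_append, List.append_nil, List.filter_eq_self]
    exact fun g hg => decide_eq_true (inside j t g hg)
  rw [parallel, ← List.flatMap_def, List.filter_flatMap]
  simp only [hinner]
  exact List.flatMap_range_getD _ (hV j)

omit [DecidableEq ι] in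
theorem Circuit.length_parallel : (parallel d V).length = d := by
  simp [parallel]

end Parallel

/-! ### The reconstruction process -/

section Reconstruction

open ResetCircuit

/-- The part of the reconstruction process that belongs to one layer of the covering scheme. -/
def reconstructionStage [DecidableEq ι] {m : ℕ} (d : ℕ) (S : Fin m → Finset ι)
    (V : Fin m → Circuit ι) : ResetCircuit ι :=
  List.map Step.gates (Circuit.parallel d V) ++ [Step.reset (Finset.univ.biUnion S)]
    ++ List.map Step.gates (Circuit.parallel d V).inv

variable [DecidableEq ι] {m d : ℕ} {S : Fin m → Finset ι} {V : Fin m → Circuit ι}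

theorem gates_mem_reconstructionStage {L : Layer ι}
    (hL : Step.gates L ∈ reconstructionStage d S V) :
    L ∈ Circuit.parallel d V ∨ L ∈ (Circuit.parallel d V).inv := by
  simpa [reconstructionStage] using hL

theorem gateDepth_reconstructionStage :
    gateDepth (reconstructionStage d S V) = 2 * d := by
  simp only [reconstructionStage, gateDepth_append, gateDepth_gates, gateDepth,
    Circuit.length_parallel, Circuit.inv, List.length_reverse, List.length_map]
  omega

omit [DecidableEq ι] in
theorem gateDepth_flatMap {α : Type*} {F : α → ResetCircuit ι} {n : ℕ}
    (hF : ∀ a, gateDepth (F a) = n) (l : List α) : gateDepth (l.flatMap F) = l.length * n := by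
  induction l with
  | nil => simp [gateDepth]
  | cons a l ih => rw [List.flatMap_cons, gateDepth_append, hF, ih, List.length_cons]; ring

theorem resetCount_append (W W' : ResetCircuit ι) (q : ι) :
    resetCount (W ++ W') q = resetCount W q + resetCount W' q := by
  induction W with
  | nil => simp [resetCount]
  | cons t W ih => cases t <;> simp [resetCount, ih]; omega

theorem resetCount_gates (K : Circuit ι) (q : ι) :
    resetCount (List.map Step.gates K) q = 0 := by
  induction K with
  | nil => rfl
  | cons L K ih => simpa [resetCount] using ih

theorem resetCount_reconstructionStage_le (q : ι) :
    resetCount (reconstructionStage d S V) q ≤ 1 := by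
  simp only [reconstructionStage, resetCount_append, resetCount_gates, resetCount]
  split_ifs <;> omega

theorem resetCount_flatMap_le {α : Type*} {F : α → ResetCircuit ι} {q : ι}
    (hF : ∀ a, resetCount (F a) q ≤ 1) (l : List α) : resetCount (l.flatMap F) q ≤ l.length := by
  induction l with
  | nil => simp [resetCount]
  | cons a l ih =>
    rw [List.flatMap_cons, resetCount_append, List.length_cons]
    have := hF a
    omega

variable [Fintype ι] {G : SimpleGraph ι} {ψ : StateVec ι}

/-- Local inversions of regions with disjoint neighbourhoods, run in parallel, invert all of them:
each of them may be applied first, and the others do not touch its region. -/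
theorem vanishes_parallel (hd : Pairwise fun j j' => Disjoint (ball G (S j) d) (ball G (S j') d))
    (hV : ∀ j, IsLocalInversion G ψ (S j) d (V j)) :
    Vanishes (Finset.univ.biUnion S : Finset ι)
      (Layer.act (Circuit.parallel d V).flatten ψ) := by
  intro x hx q hq
  obtain ⟨j, _, hq⟩ := Finset.mem_biUnion.1 hq
  let p : Gate ι → Bool := fun g => decide (g.support ⊆ ball G (S j) d)
  have hout : ∀ g ∈ (Circuit.parallel d V).flatten, p g = false →
      Disjoint (ball G (S j) d) g.support := by
    intro g hg hpg
    obtain ⟨L, hL, hg⟩ := List.mem_flatten.1 hg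
    obtain ⟨j', M, hM, hg⟩ := Circuit.mem_parallel hL hg
    have hsub := (hV j').supported M hM g hg
    have hne : j ≠ j' := by
      rintro rfl
      simp [p, hsub] at hpg
    exact Finset.disjoint_of_subset_right hsub (hd hne)
  rw [Layer.act_eq_act_filter p fun g _ g' hg' hpg hpg' =>
      Finset.disjoint_of_subset_left (of_decide_eq_true hpg) (hout g' hg' hpg'),
    Circuit.filter_parallel (fun j => (hV j).depth.length_le) (fun j => (hV j).supported) hd,
    ← Circuit.op_mulVec] at hx
  obtain ⟨φ, _, e⟩ := (hV j).inverts
  rw [e] at hx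
  refine Layer.Avoids.vanishes_act ?_ (vanishes_zeroOn (S j) φ) x hx q hq
  intro g hg
  obtain ⟨hg, hpg⟩ := List.mem_filter.1 hg
  have hdis := hout g hg (by simpa using hpg)
  have hS := subset_ball G (S j) d
  exact ⟨fun h => Finset.disjoint_left.1 hdis (hS h) (Gate.mem_support.2 (Or.inl rfl)),
    fun h => Finset.disjoint_left.1 hdis (hS h) (Gate.mem_support.2 (Or.inr rfl))⟩

theorem isDepth_parallel
    (hd : Pairwise fun j j' => Disjoint (ball G (S j) d) (ball G (S j') d))
    (hV : ∀ j, IsLocalInversion G ψ (S j) d (V j)) :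
    (Circuit.parallel d V).IsDepth d where
  length_le := Circuit.length_parallel.le
  valid := Circuit.valid_parallel (fun j => (hV j).depth.valid) (fun j => (hV j).supported) hd

theorem cleanRun_reconstructionStage
    (hd : Pairwise fun j j' => Disjoint (ball G (S j) d) (ball G (S j') d))
    (hV : ∀ j, IsLocalInversion G ψ (S j) d (V j)) :
    CleanRun (reconstructionStage d S V) ψ ψ := by
  rw [reconstructionStage, List.append_assoc]
  refine (cleanRun_gates _ ψ).append ⟨vanishes_parallel hd hV, ?_⟩
  have h := cleanRun_gates (Circuit.parallel d V).inv (Layer.act (Circuit.parallel d V).flatten ψ)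
  rwa [Circuit.act_inv_act (isDepth_parallel hd hV).valid] at h

variable {ℓ c : ℕ} {𝒮 : CoveringScheme G ℓ c d} {V : (i : Fin ℓ) → Fin (𝒮.m i) → Circuit ι}

theorem cleanRun_reconstruction (hV : ∀ i j, IsLocalInversion G ψ (𝒮.S i j) d (V i j)) :
    CleanRun (reconstruction d 𝒮.S V) ψ ψ := by
  have h : ∀ l : List (Fin ℓ),
      CleanRun (l.flatMap fun i => reconstructionStage d (𝒮.S i) (V i)) ψ ψ := by
    intro l
    induction l with
    | nil => exact rfl
    | cons i l ih =>
      exact (cleanRun_reconstructionStage (𝒮.disjoint_balls i) (hV i)).append ih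
  exact h _

theorem valid_reconstruction (hV : ∀ i j, IsLocalInversion G ψ (𝒮.S i j) d (V i j))
    {L : Layer ι} (hL : Step.gates L ∈ reconstruction d 𝒮.S V) : L.IsValid := by
  obtain ⟨i, _, hL⟩ := List.mem_flatMap.1 hL
  have hP := isDepth_parallel (𝒮.disjoint_balls i) (hV i)
  exact (gates_mem_reconstructionStage hL).elim (hP.valid L) (hP.inv.valid L)

theorem adj_of_mem_reconstructionStage {i : Fin ℓ}
    (hV : ∀ i j, IsLocalInversion G ψ (𝒮.S i j) d (V i j))
    {L : Layer ι} (hL : Step.gates L ∈ reconstructionStage d (𝒮.S i) (V i)) :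
    ∀ g ∈ L, G.Adj g.fst g.snd := by
  have hP : (Circuit.parallel d (V i)).IsLocal G := by
    intro L hL g hg
    obtain ⟨j, M, hM, hg⟩ := Circuit.mem_parallel hL hg
    exact (hV i j).isLocal M hM g hg
  exact (gates_mem_reconstructionStage hL).elim (hP L) (hP.inv L)

/-- The reconstruction process from the resets of layer `i` on, followed by the layers in `l`. -/
def reconstructionTail (𝒮 : CoveringScheme G ℓ c d) (V : (i : Fin ℓ) → Fin (𝒮.m i) → Circuit ι)
    (i : Fin ℓ) (l : List (Fin ℓ)) : ResetCircuit ι :=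
  .reset (Finset.univ.biUnion (𝒮.S i)) :: (List.map Step.gates (Circuit.parallel d (V i)).inv
    ++ l.flatMap fun i => reconstructionStage d (𝒮.S i) (V i))

theorem flatMap_reconstructionStage_cons (i : Fin ℓ) (l : List (Fin ℓ)) :
    (i :: l).flatMap (fun i => reconstructionStage d (𝒮.S i) (V i)) =
      List.map Step.gates (Circuit.parallel d (V i)) ++ reconstructionTail 𝒮 V i l := by
  simp [reconstructionStage, reconstructionTail]

theorem gateDepth_reconstructionTail (i : Fin ℓ) (l : List (Fin ℓ)) :
    gateDepth (reconstructionTail 𝒮 V i l) = (2 * l.length + 1) * d := by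
  rw [reconstructionTail, gateDepth, gateDepth_append, gateDepth_gates,
    gateDepth_flatMap fun _ => gateDepth_reconstructionStage, Circuit.inv, List.length_reverse,
    List.length_map, Circuit.length_parallel]
  ring

/-- The lightcone of `v` ends at the resets of a layer one of whose regions contains the ball of
radius `(2ℓ - 1)d` around `v`, because until there it stays inside this ball. -/
theorem blue_reconstructionTail (hV : ∀ i j, IsLocalInversion G ψ (𝒮.S i j) d (V i j))
    {v : ι} {i : Fin ℓ} {j : Fin (𝒮.m i)} (hv : ball G {v} ((2 * ℓ - 1) * d) ⊆ 𝒮.S i j)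
    {l : List (Fin ℓ)} (hl : l.length < ℓ) :
    blue {v} (reconstructionTail 𝒮 V i l) = ∅ := by
  have hdep : gateDepth (reconstructionTail 𝒮 V i l) ≤ (2 * ℓ - 1) * d := by
    rw [gateDepth_reconstructionTail]
    exact Nat.mul_le_mul_right d (by omega)
  rw [reconstructionTail, gateDepth] at hdep
  rw [reconstructionTail, blue, Finset.sdiff_eq_empty_iff_subset]
  intro q hq
  obtain ⟨a, ha, h⟩ := exists_edist_le_of_mem_blue (G := G) (fun L hL => by
    rcases List.mem_append.1 hL with hL | hL
    · exact adj_of_mem_reconstructionStage hV (List.mem_append_right _ hL)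
    · obtain ⟨i', _, hL⟩ := List.mem_flatMap.1 hL
      exact adj_of_mem_reconstructionStage hV hL) hq
  exact Finset.mem_biUnion.2 ⟨j, Finset.mem_univ j,
    hv (mem_ball.2 ⟨a, ha, h.trans (by exact_mod_cast hdep)⟩)⟩

/-- The lightcone of all outputs does not extend below the first resets of the reconstruction
process, so that of its `2ℓd` layers of gates only the last `(2ℓ - 1)d` can contain green gates. -/
theorem exists_reconstruction_eq (hV : ∀ i j, IsLocalInversion G ψ (𝒮.S i j) d (V i j)) :
    ∃ (K : Circuit ι) (W : ResetCircuit ι),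
      reconstruction d 𝒮.S V = List.map Step.gates K ++ W ∧ blue Finset.univ W = ∅ ∧
        gateDepth W ≤ (2 * ℓ - 1) * d := by
  cases ℓ with
  | zero =>
    refine ⟨[], [], rfl, ?_, by simp [gateDepth]⟩
    refine Finset.eq_empty_of_forall_notMem fun v _ => ?_
    obtain ⟨i, _⟩ := 𝒮.covers v
    exact i.elim0
  | succ n =>
    refine ⟨Circuit.parallel d (V 0),
      reconstructionTail 𝒮 V 0 ((List.finRange n).map Fin.succ), ?_, ?_, ?_⟩
    · rw [← flatMap_reconstructionStage_cons, ← List.finRange_succ]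
      rfl
    · refine Finset.eq_empty_of_forall_notMem fun q hq => ?_
      obtain ⟨v, _, hq⟩ := mem_blue_iff.1 hq
      obtain ⟨i, j, hv⟩ := 𝒮.covers v
      have hlen : ((List.finRange n).map Fin.succ).length = n := by simp
      by_cases hi : i = 0
      · subst hi
        rw [blue_reconstructionTail hV hv (by omega)] at hq
        simp at hq
      · obtain ⟨i', rfl⟩ := Fin.exists_succ_eq.2 hi
        obtain ⟨s, t, e⟩ := List.append_of_mem
          (List.mem_map_of_mem (f := Fin.succ) (List.mem_finRange i'))
        have ht : t.length < n + 1 := by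
          have := congrArg List.length e
          simp only [hlen, List.length_append, List.length_cons] at this
          omega
        rw [e, reconstructionTail, List.flatMap_append, flatMap_reconstructionStage_cons,
          ← List.append_assoc, ← List.append_assoc, ← List.cons_append, blue_append,
          blue_reconstructionTail hV hv ht, blue_empty] at hq
        simp at hq
    · rw [gateDepth_reconstructionTail]
      simp only [List.length_map, List.length_finRange]
      exact Nat.mul_le_mul_right d (by omega)

omit [Fintype ι] in
/-- Layers of gates below the end of the lightcone contribute nothing to it. -/
theorem backwardLightcone_gates_append {A : Finset ι} {W : ResetCircuit ι} (hW : blue A W = ∅)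
    (K : Circuit ι) :
    backwardLightcone A (List.map Step.gates K ++ W) = backwardLightcone A W := by
  induction K with
  | nil => rfl
  | cons L K ih =>
    have e : blue A (List.map Step.gates K ++ W) = ∅ := by rw [blue_append, hW, blue_empty]
    rw [← ih]
    simp [backwardLightcone, greenLayers, e, greenGates]

end Reconstruction

/-! ### The lightcone as a circuit on its own wires -/

section Extract

open ResetCircuit

theorem Gate.act_map_extend [DecidableEq ι] [DecidableEq κ] (e : ι ↪ κ) (w : κ → Fin 2)
    (g : Gate ι) (F : StateVec κ) :
    (fun x => (g.map e).act F (Function.extend e x w)) =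
      g.act fun x => F (Function.extend e x w) := by
  funext x
  rw [Gate.act, Gate.act]
  refine Finset.sum_congr rfl fun p _ => ?_
  have h : (g.map e).overwrite (Function.extend e x w) p =
      Function.extend e (g.overwrite x p) w := by
    funext k
    by_cases hk : k ∈ Set.range e
    · obtain ⟨q, rfl⟩ := hk
      rw [e.injective.extend_apply, Gate.overwrite_apply, Gate.overwrite_apply]
      simp [Gate.map, e.injective.extend_apply]
    · rw [Gate.overwrite_map_of_notMem e g _ p hk, Function.extend_apply' _ _ _ hk,
        Function.extend_apply' _ _ _ hk]
  rw [h]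
  simp [Gate.map, e.injective.extend_apply]

/-- A circuit on the wires in the range of `e` acts on the bits there, for each fixed value `w` of
the other bits. -/
theorem Layer.act_map_extend [DecidableEq ι] [DecidableEq κ] (e : ι ↪ κ) (w : κ → Fin 2)
    (L : Layer ι) (F : StateVec κ) (x : ι → Fin 2) :
    Layer.act (L.map (Gate.map e)) F (Function.extend e x w) =
      Layer.act L (fun x => F (Function.extend e x w)) x := by
  induction L generalizing F with
  | nil => rfl
  | cons g L ih => rw [List.map_cons, Layer.act_cons, Layer.act_cons, ih, Gate.act_map_extend]

theorem Circuit.exists_map_eq {e : ι ↪ κ} {K : Circuit κ}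
    (hK : ∀ L ∈ K, ∀ g ∈ L, g.fst ∈ Set.range e ∧ g.snd ∈ Set.range e) :
    ∃ C : Circuit ι, C.map e = K := by
  have hL : ∀ L ∈ K, L ∈ Set.range (List.map (Gate.map e)) := by
    intro L hL
    rw [Set.range_list_map]
    intro g hg
    obtain ⟨⟨a, ha⟩, b, hb⟩ := hK L hL g hg
    obtain ⟨x, y, hne, M⟩ := g
    subst ha hb
    exact ⟨⟨a, b, fun h => hne (congrArg e h), M⟩, rfl⟩
  have : K ∈ Set.range (List.map (List.map (Gate.map e))) := by
    rw [Set.range_list_map]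
    exact hL
  exact this

variable [DecidableEq ι] [Fintype ι]

omit [Fintype ι] in
theorem flatten_backwardLightcone (A : Finset ι) (W : ResetCircuit ι) :
    (backwardLightcone A W).flatten = (greenLayers A W).flatten :=
  List.flatten_filter_not_isEmpty

omit [DecidableEq ι] in
theorem exists_sum_embedding [DecidableEq κ] (f : ι ↪ κ) {T : Finset κ} (hf : ∀ q, f q ∈ T) :
    ∃ (m : ℕ) (e : ι ⊕ Fin m ↪ κ), (∀ q, e (Sum.inl q) = f q) ∧ Set.range e = (T : Set κ) := by
  let D := T \ Finset.univ.map f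
  let em := D.equivFin.symm
  have hD : ∀ a q, (em a).1 ≠ f q := fun a q h =>
    (Finset.mem_sdiff.1 (em a).2).2 (h ▸ Finset.mem_map_of_mem f (Finset.mem_univ q))
  refine ⟨D.card, ⟨Sum.elim f fun a => (em a).1, f.injective.sumElim
    (Subtype.val_injective.comp em.injective) fun q a h => hD a q h.symm⟩, fun q => rfl, ?_⟩
  ext k
  constructor
  · rintro ⟨q | a, rfl⟩
    · exact hf q
    · exact (Finset.mem_sdiff.1 (em a).2).1
  · intro hk
    by_cases hkA : k ∈ Finset.univ.map f
    · obtain ⟨q, _, rfl⟩ := Finset.mem_map.1 hkA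
      exact ⟨Sum.inl q, rfl⟩
    · refine ⟨Sum.inr (em.symm ⟨k, Finset.mem_sdiff.2 ⟨hk, hkA⟩⟩), ?_⟩
      exact congrArg Subtype.val (em.apply_symm_apply ⟨k, Finset.mem_sdiff.2 ⟨hk, hkA⟩⟩)

/-- If every reset of `W` finds its qubits in the state `|0⟩` and the lightcone of all outputs does
not reach the input, then the lightcone prepares `ψ` together with some state of its other wires. -/
theorem exists_lightcone_circuit {W : ResetCircuit ι} {ψ : StateVec ι} (hψ : IsState ψ)
    (hvalid : ∀ L : Layer ι, Step.gates L ∈ W → L.IsValid) (hrun : W.CleanRun ψ ψ)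
    (hblue : W.blue Finset.univ = ∅) :
    ∃ (m : ℕ) (e : ι ⊕ Fin m ↪ ι × ℕ) (C : Circuit (ι ⊕ Fin m)),
      (∀ q, e (Sum.inl q) = (q, 0)) ∧
      Set.range e = (W.lightconeWires Finset.univ : Set (ι × ℕ)) ∧
      C.map e = W.backwardLightcone Finset.univ ∧
      (∀ L ∈ C, Layer.IsValid L) ∧
      ∃ junk : StateVec (Fin m), IsState junk ∧
        C.op *ᵥ zeroState (ι ⊕ Fin m) = tensor ψ junk := by
  set A : Finset (ι × ℕ) := Finset.univ.map (wire ([] : ResetCircuit ι)) with hA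
  set T := W.lightconeWires Finset.univ
  have hTblue : T = _ := lightconeWires_eq_blue Finset.univ W
  have hAT : A ⊆ T := by
    rw [hTblue]
    exact Circuit.subset_blue _ _
  have hmemA : ∀ k : ι × ℕ, k ∈ A ↔ k ∈ Set.range (wire ([] : ResetCircuit ι)) := by
    simp [hA]
  have hvalidD := valid_diagram hvalid
  obtain ⟨m, e, he, hrange⟩ := exists_sum_embedding (wire ([] : ResetCircuit ι))
    fun q => hAT ((hmemA _).2 ⟨q, rfl⟩)
  obtain ⟨C, hC⟩ := Circuit.exists_map_eq (e := e) (K := W.backwardLightcone Finset.univ) (by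
    intro L hL g hg
    have hL := (List.mem_filter.1 hL).1
    rw [greenLayers_eq_cone] at hL
    have hs := Circuit.support_subset_blue hL hg
    rw [← lightconeWires_eq_blue] at hs
    rw [hrange]
    exact ⟨hs (Gate.mem_support.2 (Or.inl rfl)), hs (Gate.mem_support.2 (Or.inr rfl))⟩)
  have hCflat : C.flatten.map (Gate.map e) =
      (W.diagram.cone A).flatten := by
    rw [hA, ← greenLayers_eq_cone, ← flatten_backwardLightcone, ← hC, Circuit.map,
      List.map_flatten]
  refine ⟨m, e, C, he, hrange, hC, ?_, ?_⟩
  · intro L hL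
    have hL' : L.map (Gate.map e) ∈ W.backwardLightcone Finset.univ := by
      rw [← hC]
      exact List.mem_map_of_mem hL
    have hL' := (List.mem_filter.1 hL').1
    rw [greenLayers_eq_cone] at hL'
    exact Layer.isValid_map.1 (Circuit.valid_cone hvalidD _ hL')
  obtain ⟨N, hN, hcone⟩ := Circuit.exists_cone_eq A hvalidD
  -- an amplitude of `ψ` that does not vanish, used to contract the input wires
  obtain ⟨y, hy⟩ : ∃ y, ψ y ≠ 0 := by
    by_contra! h
    simp [IsState, h] at hψ
  have hbot : ∀ q, wire W q ∉ Set.range e := by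
    intro q
    rw [hrange, Finset.mem_coe, wire_mem_lightconeWires, hblue]
    simp
  let w : ι × ℕ → Fin 2 := fun k => if k.2 = resetCount W k.1 then y k.1 else 0
  have hw : ∀ q, w (wire W q) = y q := fun q => if_pos rfl
  have hw0 : ∀ k ∉ Set.range (wire W), w k = 0 := by
    intro k hk
    refine if_neg fun h => hk ⟨k.1, ?_⟩
    rw [← Prod.eta k]
    exact Prod.ext rfl h.symm
  -- with the bits outside the lightcone fixed to `w`, the initial state of all wires is a multiple
  -- of the all-zero state of the lightcone
  have hin : (fun x => embed (wire W) ψ (Function.extend e x w)) = ψ y • zeroState _ := by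
    funext x
    have h1 : Function.extend e x w ∘ wire W = y := by
      funext q
      rw [Function.comp_apply, Function.extend_apply' _ _ _ (hbot q), hw]
    have h2 : (∀ k ∉ Set.range (wire W), Function.extend e x w k = 0) ↔ x = 0 := by
      constructor
      · intro h
        funext a
        rw [← e.injective.extend_apply x w a]
        refine h _ ?_
        rintro ⟨q, hq⟩
        exact hbot q (hq ▸ Set.mem_range_self a)
      · rintro rfl k hk
        by_cases hk' : k ∈ Set.range e
        · obtain ⟨a, rfl⟩ := hk'
          rw [e.injective.extend_apply]
          rfl
        · rw [Function.extend_apply' _ _ _ hk', hw0 k hk]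
    simp only [embed, h1, h2, Pi.smul_apply, zeroState, smul_eq_mul, mul_ite, mul_one, mul_zero]
  -- the final state of all wires is a product of `ψ` on the output wires, untouched by `N`, and
  -- a vector `h₀` on the other wires, which `N` takes to the junk
  let h₁ : StateVec (ι × ℕ) := fun z => ψ (z ∘ wire ([] : ResetCircuit ι))
  let h₀ : StateVec (ι × ℕ) := embed (wire []) 1
  have hout : embed (wire []) ψ = h₁ * h₀ := by
    funext z
    simp [embed, h₁, h₀]
  have hdep₁ : DependsOn h₁ (A : Set (ι × ℕ)) := by
    intro x x' hx
    exact congrArg ψ (funext fun q => hx _ ((hmemA _).2 ⟨q, rfl⟩))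
  have hdep₀ : DependsOn h₀ (A : Set (ι × ℕ))ᶜ := by
    intro x x' hx
    have : (∀ k ∉ Set.range (wire ([] : ResetCircuit ι)), x k = 0) ↔
        ∀ k ∉ Set.range (wire ([] : ResetCircuit ι)), x' k = 0 :=
      forall₂_congr fun k hk => by rw [hx k fun h => hk ((hmemA k).1 h)]
    by_cases hz : ∀ k ∉ Set.range (wire ([] : ResetCircuit ι)), x k = 0
    · simp only [h₀, embed, if_pos hz, if_pos (this.1 hz), Pi.one_apply]
    · simp only [h₀, embed, if_neg hz, if_neg (mt this.2 hz)]
  have hJ := hN.dependsOn_act hdep₀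
  let junk : StateVec (Fin m) := fun z =>
    Layer.act N h₀ (Function.extend e (Sum.elim 0 z) w) / ψ y
  have key : C.op *ᵥ zeroState (ι ⊕ Fin m) = tensor ψ junk := by
    have hmain : ψ y • (C.op *ᵥ zeroState (ι ⊕ Fin m)) =
        fun x => Layer.act (W.diagram.cone A).flatten (embed (wire W) ψ)
          (Function.extend e x w) := by
      funext x
      rw [← hCflat, Layer.act_map_extend, hin, ← Circuit.op_mulVec, Matrix.mulVec_smul]
    funext x
    have hx := congrFun hmain x
    rw [hcone, hrun.act_diagram, hout, hN.act_mul hdep₁, Pi.smul_apply, Pi.mul_apply,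
      smul_eq_mul] at hx
    have e1 : h₁ (Function.extend e x w) = ψ (x ∘ Sum.inl) :=
      congrArg ψ (funext fun q => by
        rw [Function.comp_apply, ← he, e.injective.extend_apply, Function.comp_apply])
    have e2 : Layer.act N h₀ (Function.extend e x w) =
        Layer.act N h₀ (Function.extend e (Sum.elim 0 (x ∘ Sum.inr)) w) := by
      refine hJ fun k hk => ?_
      by_cases hk' : k ∈ Set.range e
      · obtain ⟨q | a, rfl⟩ := hk'
        · exact absurd ((hmemA _).2 ⟨q, (he q).symm⟩) hk
        · rw [e.injective.extend_apply, e.injective.extend_apply]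
          rfl
      · rw [Function.extend_apply' _ _ _ hk', Function.extend_apply' _ _ _ hk']
    rw [e1, e2] at hx
    rw [tensor, mul_div_assoc', ← hx, mul_div_cancel_left₀ _ hy]
  refine ⟨junk, hψ.of_tensor ?_, key⟩
  rw [← key, Circuit.op_mulVec]
  exact isState_zeroState.act _

end Extract

end ShallowLearning

theorem mainTheorem3 {k : ℕ} (Λ : Finset (Fin k → ℤ)) (ℓ c d : ℕ)
    (U : Circuit Λ) (hU : U.IsDepth d) (hUloc : U.IsLocal (latticeGraph Λ))
    (ψ : StateVec Λ) (hψ : ψ = U.op *ᵥ zeroState Λ)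
    (𝒮 : CoveringScheme (latticeGraph Λ) ℓ c d) :
    -- local inversions of all regions, hence reconstruction processes, exist
    (∀ i j, ∃ V, IsLocalInversion (latticeGraph Λ) ψ (𝒮.S i j) d V) ∧
    -- every reconstruction process `W` has the stated properties
    ∀ V : (i : Fin ℓ) → Fin (𝒮.m i) → Circuit Λ,
      (∀ i j, IsLocalInversion (latticeGraph Λ) ψ (𝒮.S i j) d (V i j)) →
      ∀ W : ResetCircuit Λ, W = reconstruction d 𝒮.S V →
        -- `W` fixes `ψ`
        W.channel (pureState ψ) = pureState ψ ∧
        -- the backward lightcone of all output wires does not reach the input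
        W.blue Finset.univ = ∅ ∧
        -- it is a circuit `C` on the `n` output wires and `m` further wires of `W`
        ∃ (m : ℕ) (e : Λ ⊕ Fin m ↪ Λ × ℕ) (C : Circuit (Λ ⊕ Fin m)),
          (∀ q, e (Sum.inl q) = (q, 0)) ∧
          Set.range e = (W.lightconeWires Finset.univ : Set (Λ × ℕ)) ∧
          C.map e = W.backwardLightcone Finset.univ ∧
          C.IsDepth ((2 * ℓ - 1) * d) ∧
          m ≤ (ℓ - 1) * Λ.card ∧
          -- `C |0^n⟩|0^m⟩ = |ψ⟩|junk⟩`
          ∃ junk : StateVec (Fin m), IsState junk ∧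
            C.op *ᵥ zeroState (Λ ⊕ Fin m) = tensor ψ junk := by
  have hstate : IsState ψ := by
    rw [hψ, Circuit.op_mulVec]
    exact isState_zeroState.act _
  refine ⟨fun i j => hψ ▸ exists_isLocalInversion hU hUloc (𝒮.S i j), ?_⟩
  rintro V hV W rfl
  have hrun := cleanRun_reconstruction hV
  obtain ⟨K, W', hW, hblue', hdepth⟩ := exists_reconstruction_eq hV
  have hblue : (reconstruction d 𝒮.S V).blue Finset.univ = ∅ := by
    rw [hW, ResetCircuit.blue_append, hblue', ResetCircuit.blue_empty]
  obtain ⟨m, e, C, he, hrange, hC, hvalid, hjunk⟩ := exists_lightcone_circuit hstate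
    (fun L hL => valid_reconstruction hV hL) hrun hblue
  refine ⟨hrun.channel_pureState, hblue, m, e, C, he, hrange, hC, ⟨?_, hvalid⟩, ?_, hjunk⟩
  · have hlen : C.length = (C.map e).length := by simp [Circuit.map]
    rw [hlen, hC, hW, backwardLightcone_gates_append hblue']
    refine (List.length_filter_le _ _).trans ?_
    rwa [ResetCircuit.length_greenLayers]
  · -- a wire of the lightcone starts at a reset, so there are at most `ℓ` of them on each qubit
    have hmaps : ∀ a ∈ (Finset.univ : Finset (Λ ⊕ Fin m)),
        e a ∈ (Finset.univ : Finset Λ) ×ˢ Finset.range ℓ := by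
      intro a _
      have ha : e a ∈ (reconstruction d 𝒮.S V).lightconeWires Finset.univ := by
        rw [← Finset.mem_coe, ← hrange]
        exact Set.mem_range_self a
      obtain ⟨h1, h2⟩ := ResetCircuit.le_resetCount (q := (e a).1) (s := (e a).2) ha
      have h3 : (e a).2 ≠ _ := fun h => by
        have := hblue ▸ h2 h
        simp at this
      have h4 : ResetCircuit.resetCount (reconstruction d 𝒮.S V) (e a).1 ≤ ℓ := by
        have := resetCount_flatMap_le (q := (e a).1)
          (F := fun i => reconstructionStage d (𝒮.S i) (V i))
          (fun _ => resetCount_reconstructionStage_le _) (List.finRange ℓ)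
        rwa [List.length_finRange] at this
      simp only [Finset.mem_product, Finset.mem_univ, Finset.mem_range, true_and]
      omega
    have hcard := Finset.card_le_card_of_injOn e hmaps e.injective.injOn
    simp only [Finset.card_univ, Fintype.card_sum, Fintype.card_coe, Fintype.card_fin,
      Finset.card_product, Finset.card_range] at hcard
    rw [Nat.sub_mul, one_mul, mul_comm ℓ]
    omega
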